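/- Let $R$ be a commutative regular ring (noetherian, with all localizations at primes regular local rings) and $f\in R$. Let $B$ be the associative $R$-algebra generated by $e_+,e_-,u,v$ subject to $$e_\pm^2=e_\pm,\quad e_++e_-=1,\quad u=e_+ue_-,\quad v=e_-ve_+,\quad uv=fe_+,\quad vu=fe_-.$$ Let $\mathrm{CM}(B)$ be the category of right $B$-modules that are finitely generated projective as $R$-modules. Let $\mathrm{CM}(R/(f))$ be the category of finitely generated $R/(f)$-modules $C$ with $\operatorname{depth} C_{\mathfrak m}\ge \dim (R/(f))_{\mathfrak m}$ for every maximal ideal $\mathfrak m$ of $R/(f)$ (the zero module having infinite depth), i.e. of maximal Cohen--Macaulay modules. Let $i^*=-\otimes_B B/Be_-B$, regarded as a functor from right $B$-modules to $R/(f)$-modules through the natural isomorphism $R/(f)\cong B/Be_-B$. (a) If $R$ has finite Krull dimension, then $B$ is Iwanaga--Gorenstein: it is noetherian on both sides and has finite injective dimension as a left and as a right module over itself. Assume now that $f$ is a nonzerodivisor in $R$. (b) Let $M$ be a right $B$-module such that $M_+=Me_+$ is finitely generated projective over $R$ and $f$ is a nonzerodivisor on $M$. Then $M\in\mathrm{CM}(B)$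 if and only if $i^*M\in \mathrm{CM}(R/(f))$. (These assumptions hold for every $M \in \mathrm{CM}(B)$.) Moreover, an $R/(f)$-module $C$ lies in $\mathrm{CM}(R/(f))$ if and only if $C\cong i^*M$ for some $M\in\mathrm{CM}(B)$. (c) The module $e_-B$ lies in $\mathrm{CM}(B)$, the functor $i^*$ sends every morphism in $\langle e_-B\rangle$ to zero, and it induces an equivalence of categories $$\mathrm{CM}(B)/\langle e_-B\rangle\;\simeq\;\mathrm{CM}(R/(f)),$$ where $\langle e_-B\rangle$ is the ideal of the category $\mathrm{CM}(B)$ generated by the object $e_-B$ (finite sums of morphisms in $\mathrm{CM}(B)$ that factor through $e_-B$). -/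

import Mathlib

universe u

open CategoryTheory TensorProduct

noncomputable section

namespace TwoVertex

/-! ### Tensor products over a noncommutative algebra -/

section

variable (R : Type*) [CommRing R] (A : Type*) [CommRing A] [Algebra R A]
  (S : Type*) [Ring S] (N : Type*) [AddCommGroup N] [Module R N] [Module A N]
  [IsScalarTower R A N] [Module S N]

/-- The elements `b x ⊗ m - x ⊗ m b` of `N ⊗_R M`, for `x ∈ N`, `b ∈ S`, `m ∈ M`, where `N` is
a left and `M` a right `S`-module. -/
def balancedRel (M : Type*) [AddCommGroup M] [Module R M] [Module Sᵐᵒᵖ M] :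
    Submodule A (N ⊗[R] M) :=
  Submodule.span A {t | ∃ (b : S) (x : N) (m : M),
    t = (b • x) ⊗ₜ[R] m - x ⊗ₜ[R] (MulOpposite.op b • m)}

/-- The tensor product `M ⊗_S N` of a right `S`-module `M` and a left `S`-module `N`, as the
quotient of `N ⊗_R M` by the relations `b x ⊗ m = x ⊗ m b`, for an `R`-algebra `S`. It is a module
over the commutative `R`-algebra `A` that acts on `N` (commuting with `S`). -/
abbrev BalTensor (M : Type*) [AddCommGroup M] [Module R M] [Module Sᵐᵒᵖ M] :=
  (N ⊗[R] M) ⧸ balancedRel R A S N M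

variable {M : Type*} [AddCommGroup M] [Module R M] [Module Sᵐᵒᵖ M]
  {M' : Type*} [AddCommGroup M'] [Module R M'] [Module Sᵐᵒᵖ M']
  {M'' : Type*} [AddCommGroup M''] [Module R M''] [Module Sᵐᵒᵖ M'']

theorem balancedRel_le (g : M →ₗ[R] M')
    (hg : ∀ (b : S) (m : M), g (MulOpposite.op b • m) = MulOpposite.op b • g m) :
    balancedRel R A S N M ≤ (balancedRel R A S N M').comap
      (AlgebraTensorModule.map (LinearMap.id : N →ₗ[A] N) g) := by
  refine Submodule.span_le.mpr ?_
  rintro _ ⟨b, x, m, rfl⟩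
  refine Submodule.subset_span ⟨b, x, g m, ?_⟩
  rw [map_sub, AlgebraTensorModule.map_tmul, AlgebraTensorModule.map_tmul, hg,
    LinearMap.id_apply, LinearMap.id_apply]

/-- The map `g ⊗ id` on tensor products over `S`. -/
def BalTensor.map (g : M →ₗ[R] M')
    (hg : ∀ (b : S) (m : M), g (MulOpposite.op b • m) = MulOpposite.op b • g m) :
    BalTensor R A S N M →ₗ[A] BalTensor R A S N M' :=
  Submodule.mapQ _ _ (AlgebraTensorModule.map (LinearMap.id : N →ₗ[A] N) g)
    (balancedRel_le R A S N g hg)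

theorem BalTensor.map_id :
    BalTensor.map R A S N (LinearMap.id : M →ₗ[R] M) (fun _ _ => rfl) = LinearMap.id := by
  refine Submodule.linearMap_qext _ (AlgebraTensorModule.ext fun x m => ?_)
  rfl

theorem BalTensor.map_comp (g : M →ₗ[R] M') (g' : M' →ₗ[R] M'')
    (hg : ∀ (b : S) (m : M), g (MulOpposite.op b • m) = MulOpposite.op b • g m)
    (hg' : ∀ (b : S) (m : M'), g' (MulOpposite.op b • m) = MulOpposite.op b • g' m) :
    BalTensor.map R A S N (g' ∘ₗ g)
      (fun b m => (congrArg g' (hg b m)).trans (hg' b (g m))) =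
      BalTensor.map R A S N g' hg' ∘ₗ BalTensor.map R A S N g hg := by
  refine Submodule.linearMap_qext _ (AlgebraTensorModule.ext fun x m => ?_)
  rfl

end

/-! ### The path algebra `B` -/

/-- The two idempotents and the two arrows of the quiver. -/
inductive Gen : Type
  | ePlus
  | eMinus
  | u
  | v

/-- The defining relations of the path algebra inside the free associative `R`-algebra. -/
inductive Rel (R : Type u) [CommRing R] (f : R) :
    FreeAlgebra R Gen → FreeAlgebra R Gen → Prop
  | ePlus_sq : Rel R f (FreeAlgebra.ι R Gen.ePlus * FreeAlgebra.ι R Gen.ePlus)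
      (FreeAlgebra.ι R Gen.ePlus)
  | eMinus_sq : Rel R f (FreeAlgebra.ι R Gen.eMinus * FreeAlgebra.ι R Gen.eMinus)
      (FreeAlgebra.ι R Gen.eMinus)
  | sum_eq_one : Rel R f (FreeAlgebra.ι R Gen.ePlus + FreeAlgebra.ι R Gen.eMinus) 1
  | u_eq : Rel R f (FreeAlgebra.ι R Gen.u)
      (FreeAlgebra.ι R Gen.ePlus * FreeAlgebra.ι R Gen.u * FreeAlgebra.ι R Gen.eMinus)
  | v_eq : Rel R f (FreeAlgebra.ι R Gen.v)
      (FreeAlgebra.ι R Gen.eMinus * FreeAlgebra.ι R Gen.v * FreeAlgebra.ι R Gen.ePlus)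
  | u_mul_v : Rel R f (FreeAlgebra.ι R Gen.u * FreeAlgebra.ι R Gen.v)
      (f • FreeAlgebra.ι R Gen.ePlus)
  | v_mul_u : Rel R f (FreeAlgebra.ι R Gen.v * FreeAlgebra.ι R Gen.u)
      (f • FreeAlgebra.ι R Gen.eMinus)

/-- The algebra `B`: the associative `R`-algebra generated by `e₊, e₋, u, v` with relations
`e₊² = e₊`, `e₋² = e₋`, `e₊ + e₋ = 1`, `u = e₊ u e₋`, `v = e₋ v e₊`, `uv = f e₊`,
`vu = f e₋`. -/
def B (R : Type u) [CommRing R] (f : R) : Type u := RingQuot (Rel R f)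

section

variable (R : Type u) [CommRing R] (f : R)

instance : Ring (B R f) := inferInstanceAs (Ring (RingQuot (Rel R f)))

instance : Algebra R (B R f) := inferInstanceAs (Algebra R (RingQuot (Rel R f)))

/-- The quotient map from the free algebra. -/
def quotMap : FreeAlgebra R Gen →ₐ[R] B R f := RingQuot.mkAlgHom R (Rel R f)

variable {R f} in
theorem quotMap_rel {x y : FreeAlgebra R Gen} (h : Rel R f x y) :
    quotMap R f x = quotMap R f y := RingQuot.mkAlgHom_rel R h

/-- The class in `B` of a generator. -/
def gen (x : Gen) : B R f := quotMap R f (FreeAlgebra.ι R x)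

/-- The idempotent `e₊`. -/
abbrev ePlus : B R f := gen R f Gen.ePlus

/-- The idempotent `e₋`. -/
abbrev eMinus : B R f := gen R f Gen.eMinus

/-- The arrow `u`. -/
abbrev arrowU : B R f := gen R f Gen.u

/-- The arrow `v`. -/
abbrev arrowV : B R f := gen R f Gen.v

theorem arrowV_eq : arrowV R f = eMinus R f * arrowV R f * ePlus R f := by
  simpa only [gen, map_mul] using quotMap_rel (Rel.v_eq (R := R) (f := f))

theorem arrowU_mul_arrowV : arrowU R f * arrowV R f = f • ePlus R f := by
  simpa only [gen, map_mul, map_smul] using quotMap_rel (Rel.u_mul_v (R := R) (f := f))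

theorem ePlus_add_eMinus : ePlus R f + eMinus R f = 1 := by
  simpa only [gen, map_add, map_one] using
    quotMap_rel (Rel.sum_eq_one (R := R) (f := f))

/-! ### The quotient ring `B / B e₋ B` -/

/-- The two-sided ideal `B e₋ B`. -/
def idealMinus : Ideal (B R f) := (TwoSidedIdeal.span {eMinus R f}).asIdeal

instance : (idealMinus R f).IsTwoSided :=
  inferInstanceAs (TwoSidedIdeal.span {eMinus R f}).asIdeal.IsTwoSided

/-- The ring `B / B e₋ B`. -/
abbrev BBar : Type u := B R f ⧸ idealMinus R f

theorem algebraMap_f_mem : algebraMap R (B R f) f ∈ idealMinus R f := by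
  have h0 : eMinus R f ∈ idealMinus R f := by
    rw [idealMinus, TwoSidedIdeal.mem_asIdeal]
    exact TwoSidedIdeal.subset_span rfl
  have h1 : f • ePlus R f ∈ idealMinus R f := by
    rw [← arrowU_mul_arrowV, arrowV_eq]
    refine Ideal.mul_mem_left _ _ (Ideal.mul_mem_right _ _ (Ideal.mul_mem_right _ _ h0))
  have h2 : f • eMinus R f ∈ idealMinus R f := by
    rw [Algebra.smul_def]
    exact Ideal.mul_mem_left _ _ h0
  have h3 := Ideal.add_mem _ h1 h2
  rwa [← smul_add, ePlus_add_eMinus, Algebra.smul_def, mul_one] at h3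

/-- The hypersurface ring `R / (f)`. -/
abbrev Hyp : Type u := R ⧸ Ideal.span {f}

/-- The natural ring homomorphism `R / (f) → B / B e₋ B` (it is bijective). -/
def hypToBBar : Hyp R f →+* BBar R f :=
  Ideal.Quotient.lift (Ideal.span {f}) (algebraMap R (BBar R f)) (by
    have hf : algebraMap R (BBar R f) f = 0 :=
      Ideal.Quotient.eq_zero_iff_mem.mpr (algebraMap_f_mem R f)
    intro a ha
    obtain ⟨b, rfl⟩ := Ideal.mem_span_singleton'.mp ha
    rw [map_mul, hf, mul_zero])

/-- `B / B e₋ B` is an algebra over `R / (f)`. -/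
instance : Algebra (Hyp R f) (BBar R f) :=
  (hypToBBar R f).toAlgebra' (by
    intro c x
    obtain ⟨r, rfl⟩ := Ideal.Quotient.mk_surjective c
    exact Algebra.commutes r x)

instance : IsScalarTower R (Hyp R f) (BBar R f) :=
  IsScalarTower.of_algebraMap_eq (fun _ => rfl)

end

/-! ### Right `B`-modules -/

/-- The category of right `B`-modules, that is, of left modules over the opposite ring. -/
abbrev RMod (R : Type u) [CommRing R] (f : R) := ModuleCat.{u} (B R f)ᵐᵒᵖ

section

variable {R : Type u} [CommRing R] {f : R}

/-- A right `B`-module is an `R`-module by restriction of scalars. -/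
instance instModule (M : RMod R f) : Module R M :=
  Module.compHom M (algebraMap R (B R f)ᵐᵒᵖ)

instance instIsScalarTower (M : RMod R f) : IsScalarTower R (B R f)ᵐᵒᵖ M :=
  IsScalarTower.of_algebraMap_smul (fun _ _ => rfl)

/-- `CM(B)`: the right `B`-modules that are finitely generated projective over `R`. -/
def IsCM : ObjectProperty (RMod R f) :=
  fun M => Module.Finite R M ∧ Module.Projective R M

/-- The component `M₊ = M e₊` of a right `B`-module. -/
def plusPart (M : RMod R f) : Submodule R M :=
  LinearMap.range (Algebra.lsmul R R M (MulOpposite.op (ePlus R f)))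

variable (R f) in
/-- The right ideal `e₋ B`, as a right `B`-module. -/
def eMinusB : RMod R f :=
  ModuleCat.of (B R f)ᵐᵒᵖ (Submodule.span (B R f)ᵐᵒᵖ {eMinus R f} : Submodule (B R f)ᵐᵒᵖ (B R f))

/-! ### The functor `i^* = - ⊗_B (B / B e₋ B)` -/

variable (R f) in
/-- The functor `i^* = - ⊗_B (B / B e₋ B)` from right `B`-modules to `R / (f)`-modules. -/
def iStar : RMod R f ⥤ ModuleCat.{u} (Hyp R f) where
  obj M := ModuleCat.of (Hyp R f) (BalTensor R (Hyp R f) (B R f) (BBar R f) M)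
  map g := ModuleCat.ofHom
    (BalTensor.map R (Hyp R f) (B R f) (BBar R f) (g.hom.restrictScalars R)
      (fun b m => g.hom.map_smul (MulOpposite.op b) m))
  map_id _ := ModuleCat.hom_ext (BalTensor.map_id R (Hyp R f) (B R f) (BBar R f))
  map_comp g g' := ModuleCat.hom_ext
    (BalTensor.map_comp R (Hyp R f) (B R f) (BBar R f) (g.hom.restrictScalars R)
      (g'.hom.restrictScalars R) (fun b m => g.hom.map_smul (MulOpposite.op b) m)
      (fun b m => g'.hom.map_smul (MulOpposite.op b) m))

end

end TwoVertex

/-! ### Maximal Cohen-Macaulay modules over a commutative ring -/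

/-- For a commutative noetherian ring `A`, a finitely generated module `C` is (maximal)
Cohen-Macaulay when `depth C_𝔪 ≥ dim A_𝔪` for all maximal ideals `𝔪`, that is, when there is a
`C_𝔪`-regular sequence of length `dim A_𝔪` in the maximal ideal of `A_𝔪`. The zero module
has infinite depth; for nonzero finitely generated `C_𝔪` every weakly regular sequence in the
maximal ideal is regular, by Nakayama. -/
def IsMaximalCohenMacaulay (A : Type u) [CommRing A] : ObjectProperty (ModuleCat.{u} A) :=
  fun C => Module.Finite A C ∧ ∀ (m : Ideal A) [m.IsMaximal],
    ∃ rs : List (Localization.AtPrime m),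
      (∀ r ∈ rs, r ∈ IsLocalRing.maximalIdeal (Localization.AtPrime m)) ∧
      RingTheory.Sequence.IsWeaklyRegular (LocalizedModule m.primeCompl C) rs ∧
      (rs.length : WithBot ℕ∞) = ringKrullDim (Localization.AtPrime m)

/-! ### Iwanaga-Gorenstein rings -/

/-- A ring is Iwanaga-Gorenstein when it is noetherian on both sides and has finite injective
dimension as a left and as a right module over itself. -/
structure IsIwanagaGorenstein (Λ : Type u) [Ring Λ] : Prop where
  left_noetherian : IsNoetherian Λ Λ
  right_noetherian : IsNoetherian Λᵐᵒᵖ Λ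
  left_injDim : ∃ n : ℕ, HasInjectiveDimensionLE (ModuleCat.of Λ Λ) n
  right_injDim : ∃ n : ℕ, HasInjectiveDimensionLE (ModuleCat.of Λᵐᵒᵖ Λ) n

/-! ### The ideal of a preadditive category generated by an object -/

section

variable {C : Type*} [Category* C] [Preadditive C]

/-- The morphisms `Y ⟶ Z` in the ideal `⟨X⟩`: the finite sums of morphisms that factor
through `X`. -/
def objectIdeal (X Y Z : C) : AddSubgroup (Y ⟶ Z) :=
  AddSubgroup.closure {h | ∃ (a : Y ⟶ X) (b : X ⟶ Z), h = a ≫ b}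

/-- Two parallel morphisms are identified when their difference lies in the ideal `⟨X⟩`. -/
def objectIdealRel (X : C) : HomRel C :=
  fun Y Z g h => g - h ∈ objectIdeal X Y Z

end

namespace TwoVertex

variable (R : Type u) [CommRing R] (f : R)

/-- The category `CM(B)`. -/
abbrev CMB := (IsCM (R := R) (f := f)).FullSubcategory

/-- The category `CM(R / (f))`. -/
abbrev CMHyp := (IsMaximalCohenMacaulay (Hyp R f)).FullSubcategory

/-- The restriction of `i^*` to a functor from `CM(B)` to `CM(R / (f))`, given that `i^*` maps the
objects of `CM(B)` to `CM(R / (f))`. -/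
def iStarCM (hCM : ∀ M : CMB R f, IsMaximalCohenMacaulay (Hyp R f) ((iStar R f).obj M.obj)) :
    CMB R f ⥤ CMHyp R f :=
  (IsMaximalCohenMacaulay (Hyp R f)).lift (IsCM.ι ⋙ iStar R f) hCM

/-- The relation on the morphisms of `CM(B)` that identifies two morphisms when their difference
lies in the ideal `⟨e₋ B⟩`, given that `e₋ B` is an object of `CM(B)`. -/
abbrev idealRel (hE : IsCM (eMinusB R f)) : HomRel (CMB R f) :=
  objectIdealRel (⟨eMinusB R f, hE⟩ : CMB R f)

end TwoVertex

end

/-!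
The elements `e₊, e₋, u, v` form a basis of `B` over `R`, and the linear form
`p e₊ + q e₋ + r u + s v ↦ r + s` induces a perfect pairing `(a, b) ↦ t (a b)` on `B`. Hence `B` is
isomorphic to `Hom_R(B, R)` on both sides. Coinduction `Hom_R(B, -)` is an exact right adjoint as `B` is
free over `R`, so the injective dimension of `B` on either side is at most that of `R`, which is finite
by Baer's criterion and `IsRegularRing.hasProjectiveDimensionLE`.

A right `B`-module is a pair of `R`-modules `M₊ = M e₊`, `M₋ = M e₋` with maps `u : M₊ → M₋` and
`v : M₋ → M₊` whose composites are multiplication by `f`, and `i^* M` is the cokernel of `v`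
(`exact_arrowVMap_plusToIStar`). If `f` is regular on `M`, then `v` is injective, and
`0 → M₋ → M₊ → i^* M → 0` is exact. On the other hand, `isMaximalCohenMacaulay_quotient_iff` identifies
the maximal Cohen-Macaulay modules over `R / (f)` with the finitely generated ones of projective
dimension at most one over `R`: locally, this is the Auslander-Buchsbaum formula together with
the drop of the dimension by one from `R_𝔪` to `R_𝔪 / (f)`. So if `M₊` is finitely generated
projective, then `M₋` is projective exactly when `i^* M` is maximal Cohen-Macaulay. Conversely, a
presentation `0 → K → P → C → 0` of such a module `C` gives a right `B`-module with `M₊ = P`, `M₋ = K`,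
on which `v` acts by the inclusion and `u` by `f` (`exists_isCM_iStar_iso`).

As `M₊` is projective, a homomorphism `i^* M → i^* N` lifts to `M₊ → N₊`, and then to `M → N`, which gives
fullness. If `g : M → N` induces zero on `i^*`, then `M₊ → N₊` factors through `v` by a map
`s : M₊ → N₋`; a dual basis of `M₊` writes `s` as a sum of maps of rank one, each of which accounts for a
morphism that factors through `e₋ B`, and this gives faithfulness
(`mem_objectIdeal_of_toIStar_eq_zero`).
-/

/-! ### Regular local rings -/

section RegularLocal
open IsLocalRing RingTheory.Sequence

variable {S : Type u} [CommRing S]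

/-- An element of `𝔪 ∖ 𝔪²` can replace one of the elements of a minimal system of generators of `𝔪`,
so that modulo it the embedding dimension drops. -/
theorem IsLocalRing.spanFinrank_maximalIdeal_quotient_succ_le [IsLocalRing S] [IsNoetherianRing S]
    {x : S} [IsLocalRing (S ⧸ Ideal.span {x})] (hx : x ∈ maximalIdeal S)
    (hx2 : x ∉ maximalIdeal S ^ 2) :
    (maximalIdeal (S ⧸ Ideal.span {x})).spanFinrank + 1 ≤ (maximalIdeal S).spanFinrank := by
  classical
  obtain ⟨T, hTc, hT⟩ := Submodule.FG.exists_span_finset_card_eq_spanFinrank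
    (maximalIdeal S).fg_of_isNoetherianRing
  have hTm : ∀ t ∈ T, t ∈ maximalIdeal S := fun t ht => hT ▸ Submodule.subset_span ht
  obtain ⟨a, ha⟩ : ∃ a : S → S, ∑ t ∈ T, a t • t = x := by
    rw [← hT] at hx
    exact (Submodule.mem_span_finset'.mp hx).elim fun a ha =>
      ⟨fun s => if h : s ∈ T then a ⟨s, h⟩ else 0, by
        rw [← ha, ← Finset.sum_coe_sort T]; simp⟩
  -- otherwise `x` would be in `𝔪²`
  obtain ⟨t, ht, hu⟩ : ∃ t ∈ T, IsUnit (a t) := by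
    by_contra! h
    apply hx2
    rw [← ha, pow_two]
    exact Ideal.sum_mem _ fun t ht => Ideal.mul_mem_mul ((mem_maximalIdeal _).mpr (h t ht))
      (hTm t ht)
  set q := Ideal.Quotient.mk (Ideal.span {x}) with hq
  have hmap : maximalIdeal (S ⧸ Ideal.span {x}) = (maximalIdeal S).map q := by
    have := IsLocalRing.map_maximalIdeal_of_surjective q Ideal.Quotient.mk_surjective
    exact this.symm
  have hle : maximalIdeal (S ⧸ Ideal.span {x}) =
      Submodule.span _ (((T.erase t).image q : Finset (S ⧸ Ideal.span {x})) : Set _) := by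
    apply le_antisymm
    · rw [hmap, ← hT, Ideal.map_le_iff_le_comap]
      refine Submodule.span_le.mpr fun s hs => ?_
      rcases eq_or_ne s t with rfl | hne
      · have h1 : q (a s) * q s = - ∑ t ∈ T.erase s, q (a t) * q t := by
          have h2 : q x = 0 :=
            Ideal.Quotient.eq_zero_iff_mem.mpr (Ideal.mem_span_singleton_self x)
          rw [← congrArg q ha, map_sum, ← Finset.add_sum_erase _ _ hs] at h2
          simp only [smul_eq_mul, map_mul] at h2
          exact eq_neg_of_add_eq_zero_left h2
        obtain ⟨w, hw⟩ := (hu.map q).exists_left_inv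
        have h3 : q s = w * (q (a s) * q s) := by rw [← mul_assoc, hw, one_mul]
        rw [SetLike.mem_coe, Ideal.mem_comap, h3, h1]
        refine Ideal.mul_mem_left _ _ (neg_mem (Ideal.sum_mem _ fun i hi =>
          Ideal.mul_mem_left _ _ (Submodule.subset_span ?_)))
        exact Finset.mem_coe.mpr (Finset.mem_image_of_mem q hi)
      · exact Submodule.subset_span (Finset.mem_coe.mpr
          (Finset.mem_image_of_mem q (Finset.mem_erase.mpr ⟨hne, hs⟩)))
    · refine Submodule.span_le.mpr fun s hs => ?_
      obtain ⟨s', hs', rfl⟩ := Finset.mem_image.mp (Finset.mem_coe.mp hs)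
      rw [hmap]
      exact Ideal.mem_map_of_mem q (hTm s' (Finset.mem_of_mem_erase hs'))
  have hcard := Submodule.spanFinrank_span_le_ncard_of_finite (R := S ⧸ Ideal.span {x})
    ((T.erase t).image q).finite_toSet
  rw [← hle, Set.ncard_coe_finset] at hcard
  have h4 := Finset.card_image_le (s := T.erase t) (f := q)
  rw [Finset.card_erase_of_mem ht] at h4
  have h5 := Finset.card_pos.mpr ⟨t, ht⟩
  omega

/-- Cutting a regular local ring by an element of `𝔪 ∖ 𝔪²` gives a regular local ring. -/
theorem IsRegularLocalRing.quotient_span_singleton [IsRegularLocalRing S] {x : S}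
    (hx : x ∈ maximalIdeal S) (hx2 : x ∉ maximalIdeal S ^ 2) :
    IsRegularLocalRing (S ⧸ Ideal.span {x}) ∧ ∀ [IsLocalRing (S ⧸ Ideal.span {x})],
      (maximalIdeal (S ⧸ Ideal.span {x})).spanFinrank + 1 = (maximalIdeal S).spanFinrank := by
  have hne : Ideal.span {x} ≠ ⊤ := fun h =>
    (maximalIdeal.isMaximal S).ne_top (top_le_iff.mp
      (h ▸ (Ideal.span_singleton_le_iff_mem _).mpr hx))
  have := Ideal.Quotient.nontrivial_iff.mpr hne
  have hloc : IsLocalRing (S ⧸ Ideal.span {x}) :=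
    IsLocalRing.of_surjective' _ Ideal.Quotient.mk_surjective
  have h1 := IsLocalRing.spanFinrank_maximalIdeal_quotient_succ_le hx hx2
  have h2 : ringKrullDim S ≤ ringKrullDim (S ⧸ Ideal.span {x}) + 1 := by
    have := ringKrullDim_le_ringKrullDim_quotSMulTop_succ hx
    rwa [← Submodule.ideal_span_singleton_smul, smul_eq_mul, Ideal.mul_top] at this
  have h3 := ‹IsRegularLocalRing S›.spanFinrank_maximalIdeal
  have h4 : (maximalIdeal (S ⧸ Ideal.span {x})).spanFinrank ≤
      ringKrullDim (S ⧸ Ideal.span {x}) := by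
    rw [← ENat.WithBot.add_le_add_one_right_iff]
    refine le_trans ?_ h2
    rw [← h3]
    exact_mod_cast h1
  have h5 := IsRegularLocalRing.of_spanFinrank_maximalIdeal_le _ h4
  refine ⟨h5, fun {_} => le_antisymm h1 ?_⟩
  rw [← h3, ← h5.spanFinrank_maximalIdeal] at h2
  exact_mod_cast h2

/-- Prime avoidance for the minimal primes and `𝔪²`, where one of the ideals need not be prime. -/
theorem IsLocalRing.exists_mem_maximalIdeal_notMem_sq [IsLocalRing S] [IsNoetherianRing S]
    (h : ∀ q ∈ minimalPrimes S, ¬ maximalIdeal S ≤ q) (h0 : maximalIdeal S ≠ ⊥) :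
    ∃ x ∈ maximalIdeal S, x ∉ maximalIdeal S ^ 2 ∧ ∀ q ∈ minimalPrimes S, x ∉ q := by
  by_contra! hcon
  have hfin : (insert (maximalIdeal S ^ 2) (minimalPrimes S)).Finite :=
    (minimalPrimes.finite_of_isNoetherianRing S).insert _
  obtain ⟨q, hq, hle⟩ := (Ideal.subset_union_prime_finite hfin (f := id) (I := maximalIdeal S)
    (maximalIdeal S ^ 2) (maximalIdeal S ^ 2)
    (fun i hi h1 _ => (Set.mem_of_mem_insert_of_ne hi h1).1.1)).mp (fun x hx => by
      by_cases h2 : x ∈ maximalIdeal S ^ 2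
      · exact Set.mem_biUnion (Set.mem_insert _ _) h2
      · obtain ⟨q, hq, hxq⟩ := hcon x hx h2
        exact Set.mem_biUnion (Set.mem_insert_of_mem _ hq) hxq)
  rcases hq with rfl | hq
  · refine h0 (Submodule.eq_bot_of_le_smul_of_le_jacobson_bot (maximalIdeal S) _
      (maximalIdeal S).fg_of_isNoetherianRing ?_ (maximalIdeal_le_jacobson _))
    rwa [smul_eq_mul, ← pow_two]
  · exact h q hq hle

/-- The proof is by induction on the dimension: for `x ∈ 𝔪 ∖ 𝔪²` outside all minimal primes, `S / (x)`
is a domain, so the prime `(x)` contains a minimal prime `q`; then `q = x q`, and `q = 0` by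
Nakayama. -/
theorem IsRegularLocalRing.isDomain [IsRegularLocalRing S] : IsDomain S := by
  generalize hn : (maximalIdeal S).spanFinrank = n
  induction n generalizing S with
  | zero =>
    have : maximalIdeal S = ⊥ := (Submodule.spanFinrank_eq_zero_iff_eq_bot
      (maximalIdeal S).fg_of_isNoetherianRing).mp hn
    exact (isField_iff_maximalIdeal_eq.mpr this).isDomain
  | succ n ih =>
    have hdim : ringKrullDim S = (n + 1 : ℕ) := by
      rw [← ‹IsRegularLocalRing S›.spanFinrank_maximalIdeal, hn]
    have h0 : maximalIdeal S ≠ ⊥ := fun h => by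
      rw [h, Submodule.spanFinrank_bot] at hn
      exact absurd hn (by omega)
    have hmin : ∀ q ∈ minimalPrimes S, ¬ maximalIdeal S ≤ q := fun q hq hle => by
      have := hq.1.1
      have h1 : q = maximalIdeal S := le_antisymm (le_maximalIdeal this.ne_top) hle
      have h2 := Ideal.height_eq_zero_iff.mpr (h1 ▸ hq)
      rw [← maximalIdeal_height_eq_ringKrullDim, h2] at hdim
      norm_cast at hdim
    obtain ⟨x, hx, hx2, hxq⟩ := IsLocalRing.exists_mem_maximalIdeal_notMem_sq hmin h0
    obtain ⟨hreg, hrk⟩ := IsRegularLocalRing.quotient_span_singleton hx hx2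
    have hdom := ih (S := S ⧸ Ideal.span {x}) (by have := @hrk _; omega)
    have hp : (Ideal.span {x}).IsPrime := (Ideal.Quotient.isDomain_iff_prime _).mp hdom
    obtain ⟨q, hq, hqx⟩ := Ideal.exists_minimalPrimes_le (I := (⊥ : Ideal S)) (J := Ideal.span {x})
      bot_le
    have hqp := hq.1.1
    have hq0 : q = ⊥ := by
      refine Submodule.eq_bot_of_le_smul_of_le_jacobson_bot (maximalIdeal S) _
        q.fg_of_isNoetherianRing (fun y hy => ?_) (maximalIdeal_le_jacobson _)
      obtain ⟨a, rfl⟩ := Ideal.mem_span_singleton'.mp (hqx hy)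
      have := (hqp.mem_or_mem hy).resolve_right (hxq q hq)
      rw [mul_comm]
      exact Ideal.mul_mem_mul hx this
    subst hq0
    exact IsDomain.of_bot_isPrime S

/-- A regular local ring that is not a field has a nonzerodivisor in its maximal ideal modulo
which it is regular local of dimension one less. -/
theorem IsRegularLocalRing.exists_regular_quotient [IsRegularLocalRing S] {n : ℕ}
    (hn : (maximalIdeal S).spanFinrank = n + 1) :
    ∃ x ∈ maximalIdeal S, IsSMulRegular S x ∧
      ∃ _ : IsRegularLocalRing (S ⧸ Ideal.span {x}),
        (maximalIdeal (S ⧸ Ideal.span {x})).spanFinrank = n := by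
  have := IsRegularLocalRing.isDomain (S := S)
  have h0 : maximalIdeal S ≠ ⊥ := fun h => by
    rw [h, Submodule.spanFinrank_bot] at hn
    exact absurd hn (by omega)
  obtain ⟨x, hx, hx2, hxq⟩ := IsLocalRing.exists_mem_maximalIdeal_notMem_sq (S := S)
    (fun q hq hle => h0 (by
      rw [IsDomain.minimalPrimes_eq_singleton_bot, Set.mem_singleton_iff] at hq
      exact le_bot_iff.mp (hq ▸ hle))) h0
  obtain ⟨hreg, hrk⟩ := IsRegularLocalRing.quotient_span_singleton hx hx2
  refine ⟨x, hx, ?_, hreg, by have := @hrk _; omega⟩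
  have hx0 : x ≠ 0 := fun h => hx2 (h ▸ zero_mem _)
  exact isSMulRegular_iff_right_eq_zero_of_smul.mpr fun y hy => by
    simpa [hx0] using hy

/-- A regular local ring is Cohen-Macaulay. -/
theorem IsRegularLocalRing.exists_isRegular [IsRegularLocalRing S] :
    ∃ rs : List S, (∀ r ∈ rs, r ∈ maximalIdeal S) ∧ IsRegular S rs ∧
      rs.length = (maximalIdeal S).spanFinrank := by
  generalize hn : (maximalIdeal S).spanFinrank = n
  induction n generalizing S with
  | zero => exact ⟨[], by simp, IsRegular.nil S S, rfl⟩
  | succ n ih =>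
    obtain ⟨x, hx, hreg, _, hrk⟩ := IsRegularLocalRing.exists_regular_quotient hn
    obtain ⟨rs, hmem, hrs, hlen⟩ := ih hrk
    obtain ⟨rs, rfl⟩ := List.map_surjective_iff.mpr
      (Ideal.Quotient.mk_surjective (I := Ideal.span {x})) rs
    have hmem' : ∀ r ∈ x :: rs, r ∈ maximalIdeal S := by
      intro r hr
      rcases List.mem_cons.mp hr with rfl | hr
      · exact hx
      · have := hmem _ (List.mem_map_of_mem hr)
        rw [mem_maximalIdeal, mem_nonunits_iff] at this ⊢
        exact fun hu => this (hu.map _)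
    refine ⟨x :: rs, hmem', ?_, by simpa using hlen⟩
    refine IsRegular.of_isWeaklyRegular_of_mem_maximalIdeal S hmem' (.cons hreg ?_)
    have h1 := hrs.toIsWeaklyRegular
    rw [← Ideal.Quotient.algebraMap_eq, isWeaklyRegular_map_algebraMap_iff] at h1
    refine (LinearEquiv.isWeaklyRegular_congr (Submodule.quotEquivOfEq _ _ ?_) rs).mp h1
    rw [← Submodule.ideal_span_singleton_smul, smul_eq_mul, Ideal.mul_top]

end RegularLocal

/-! ### Projective dimension over regular local rings -/

section ProjectiveDimension
open IsLocalRing RingTheory.Sequence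

variable {S : Type u} [CommRing S]

/-- For an element `x` of the maximal ideal of `S` that is regular on `S` and on `M`, the
projective dimension of `M` over `S` is at most that of `M / x M` over `S / (x)`. -/
theorem ModuleCat.hasProjectiveDimensionLE_of_quotSMulTop [IsLocalRing S] [IsNoetherianRing S]
    {x : S} (hx : x ∈ maximalIdeal S) (hS : IsSMulRegular S x) (n : ℕ)
    (M : Type u) [AddCommGroup M] [Module S M] [Module.Finite S M] (hM : IsSMulRegular M x)
    (h : HasProjectiveDimensionLE
      (ModuleCat.of.{u} (S ⧸ Ideal.span {x}) (QuotSMulTop x M)) n) :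
    HasProjectiveDimensionLE (ModuleCat.of.{u} S M) n := by
  have hntr : Nontrivial (S ⧸ Ideal.span {x}) := Ideal.Quotient.nontrivial_iff.mpr fun h =>
    (maximalIdeal.isMaximal S).ne_top (top_le_iff.mp
      (h ▸ (Ideal.span_singleton_le_iff_mem _).mpr hx))
  have hloc : IsLocalRing (S ⧸ Ideal.span {x}) :=
    IsLocalRing.of_surjective' _ Ideal.Quotient.mk_surjective
  have fin (K : Type u) [AddCommGroup K] [Module S K] [Module.Finite S K] :
      Module.Finite (S ⧸ Ideal.span {x}) (QuotSMulTop x K) :=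
    Module.Finite.of_restrictScalars_finite S _ _
  induction n generalizing M with
  | zero =>
    rw [HasProjectiveDimensionLE, zero_add, ← projective_iff_hasProjectiveDimensionLT_one,
      ← IsProjective.iff_projective] at h ⊢
    have := fin M
    have h1 : Module.Free (S ⧸ Ideal.span {x}) (QuotSMulTop x M) :=
      Module.free_of_flat_of_isLocalRing
    have := Module.finitePresentation_of_finite S M
    have := (Module.free_quotSMulTop_iff_free S M (maximalIdeal_le_jacobson _ hx) hM).mp h1
    infer_instance
  | succ n ih =>
    obtain ⟨F, _, _, _, _, g, hg⟩ := Module.exists_finite_presentation S M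
    have hF : IsSMulRegular F x :=
      ((TensorProduct.rid S F).isSMulRegular_congr x).mp (hS.lTensor F)
    have hK : IsSMulRegular (LinearMap.ker g) x := hF.submodule _ _
    have hex := LinearMap.shortExact_shortComplexKer hg
    have : Projective (g.shortComplexKer).X₂ := by
      change Projective (ModuleCat.of S F)
      rw [← IsProjective.iff_projective]; infer_instance
    refine (hex.hasProjectiveDimensionLT_X₃_iff n this).mpr (ih (LinearMap.ker g) hK ?_)
    let i' := (QuotSMulTop.map x (LinearMap.ker g).subtype).extendScalarsOfSurjective
      (Ideal.Quotient.mk_surjective (I := Ideal.span {x}))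
    let g' := (QuotSMulTop.map x g).extendScalarsOfSurjective
      (Ideal.Quotient.mk_surjective (I := Ideal.span {x}))
    have hexact : Function.Exact i' g' := QuotSMulTop.map_exact x
      (LinearMap.exact_subtype_ker_map g) hg
    have hinj : Function.Injective i' := by
      have h1 : Function.Exact (0 : LinearMap.ker g →ₗ[S] LinearMap.ker g)
          (LinearMap.ker g).subtype := fun y => by simp [eq_comm]
      have h2 := QuotSMulTop.map_first_exact_on_four_term_exact_of_isSMulRegular_last h1
        (LinearMap.exact_subtype_ker_map g) hM
      rw [injective_iff_map_eq_zero]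
      intro y hy
      obtain ⟨z, rfl⟩ := (h2 y).mp hy
      rw [map_zero, LinearMap.zero_apply]
    have hsurj : Function.Surjective g' := QuotSMulTop.map_surjective x hg
    have hex' := ModuleCat.shortComplex_shortExact
      (ModuleCat.shortComplexOfCompEqZero i' g' hexact.linearMap_comp_eq_zero) hexact hinj hsurj
    refine (hex'.hasProjectiveDimensionLT_X₃_iff n ?_).mp h
    change Projective (ModuleCat.of (S ⧸ Ideal.span {x}) (QuotSMulTop x F))
    rw [← IsProjective.iff_projective]; infer_instance

/-- Finitely generated modules over a regular local ring have projective dimension at most the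
dimension of the ring. -/
theorem IsRegularLocalRing.hasProjectiveDimensionLE [IsRegularLocalRing S] {n : ℕ}
    (hn : (maximalIdeal S).spanFinrank = n) (M : Type u) [AddCommGroup M] [Module S M]
    [Module.Finite S M] : HasProjectiveDimensionLE (ModuleCat.of.{u} S M) n := by
  induction n generalizing S M with
  | zero =>
    have h0 : maximalIdeal S = ⊥ := (Submodule.spanFinrank_eq_zero_iff_eq_bot
      (maximalIdeal S).fg_of_isNoetherianRing).mp hn
    let := (isField_iff_maximalIdeal_eq.mpr h0).toField
    rw [HasProjectiveDimensionLE, zero_add, ← projective_iff_hasProjectiveDimensionLT_one,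
      ← IsProjective.iff_projective]
    infer_instance
  | succ n ih =>
    obtain ⟨x, hx, hreg, _, hrk⟩ := IsRegularLocalRing.exists_regular_quotient hn
    obtain ⟨F, _, _, _, _, g, hg⟩ := Module.exists_finite_presentation S M
    have hF : IsSMulRegular F x :=
      ((TensorProduct.rid S F).isSMulRegular_congr x).mp (hreg.lTensor F)
    have hex := LinearMap.shortExact_shortComplexKer hg
    have hP : Projective (g.shortComplexKer).X₂ := by
      change Projective (ModuleCat.of S F)
      rw [← IsProjective.iff_projective]; infer_instance
    have := Module.Finite.of_restrictScalars_finite S (S ⧸ Ideal.span {x})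
      (QuotSMulTop x (LinearMap.ker g))
    exact (hex.hasProjectiveDimensionLT_X₃_iff n hP).mpr
      (ModuleCat.hasProjectiveDimensionLE_of_quotSMulTop hx hreg n (LinearMap.ker g)
        (hF.submodule _ _) (ih hrk _))

/-- Over a regular local ring `S`, a finitely generated module of depth at least `dim S - 1` has
projective dimension at most one. -/
theorem IsRegularLocalRing.hasProjectiveDimensionLE_one_of_isWeaklyRegular [IsRegularLocalRing S]
    (M : Type u) [AddCommGroup M] [Module S M] [Module.Finite S M] {rs : List S}
    (hrs : ∀ r ∈ rs, r ∈ maximalIdeal S) (hreg : IsWeaklyRegular M rs)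
    (hlen : rs.length + 1 = (maximalIdeal S).spanFinrank) :
    HasProjectiveDimensionLE (ModuleCat.of.{u} S M) 1 := by
  rcases subsingleton_or_nontrivial M with hM | hM
  · have := (ModuleCat.isZero_iff_subsingleton (M := ModuleCat.of S M)).mpr hM
    have := this.hasProjectiveDimensionLT_zero
    exact hasProjectiveDimensionLT_of_ge _ 0 2 (by omega)
  · have : Nontrivial (ModuleCat.of.{u} S M) := hM
    have : Module.Finite S (ModuleCat.of.{u} S M) := ‹_›
    have h1 := ModuleCat.projectiveDimension_quotient_eq_add_length_of_isWeaklyRegular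
      (ModuleCat.of.{u} S M) rs hreg hrs
    have h2 := IsRegularLocalRing.hasProjectiveDimensionLE hlen.symm
      (M ⧸ Ideal.ofList rs • (⊤ : Submodule S M))
    rw [← projectiveDimension_le_iff] at h2 ⊢
    have h3 := h1.symm.trans_le h2
    rw [add_comm rs.length 1] at h3
    push_cast at h3
    exact (ENat.WithBot.add_le_add_natCast_right_iff).mp h3

/-- Over a regular local ring `S` of positive dimension, a finitely generated module of projective
dimension at most one has depth at least `dim S - 1`. -/
theorem IsRegularLocalRing.exists_isWeaklyRegular_of_hasProjectiveDimensionLE_one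
    [IsRegularLocalRing S] (M : Type u) [AddCommGroup M] [Module S M] [Module.Finite S M]
    (h : HasProjectiveDimensionLE (ModuleCat.of.{u} S M) 1) {n : ℕ}
    (hn : n + 1 = (maximalIdeal S).spanFinrank) :
    ∃ rs : List S, (∀ r ∈ rs, r ∈ maximalIdeal S) ∧ IsWeaklyRegular M rs ∧ rs.length = n := by
  rcases subsingleton_or_nontrivial M with hM | hM
  · refine ⟨List.replicate n 0, fun r hr => ?_, ⟨fun i hi => ?_⟩, List.length_replicate⟩
    · rw [List.eq_of_mem_replicate hr]; exact zero_mem _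
    · exact fun _ _ _ => Subsingleton.elim _ _
  -- a finite projective module has depth `n + 1`, so its `Ext` groups from the residue field vanish
  -- in degrees `≤ n`; by the long exact sequence those of `M` vanish in degrees `< n`
  have free_ext (F : Type u) [AddCommGroup F] [Module S F] [Module.Finite S F]
      [Module.Projective S F] (i : ℕ) (hi : i < n + 1) :
      Subsingleton (Abelian.Ext (ModuleCat.of.{u} S (Shrink.{u} (S ⧸ maximalIdeal S)))
        (ModuleCat.of.{u} S F) i) := by
    rcases subsingleton_or_nontrivial F with hF | hF
    · have h0 := (ModuleCat.isZero_iff_subsingleton (M := ModuleCat.of S F)).mpr hF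
      have := h0.hasInjectiveDimensionLT_zero
      exact HasInjectiveDimensionLT.subsingleton _ 0 i (by omega) _
    obtain ⟨rs, hmem, hrs, hlen⟩ := IsRegularLocalRing.exists_isRegular (S := S)
    have hF' : IsWeaklyRegular F rs :=
      ((TensorProduct.rid S F).isWeaklyRegular_congr rs).mp
        (hrs.toIsWeaklyRegular.isWeaklyRegular_lTensor (M₂ := F))
    have : Module.Finite S (ModuleCat.of.{u} S F) := ‹_›
    have key := (ModuleCat.exists_isRegular_tfae (maximalIdeal S) (n + 1) (ModuleCat.of.{u} S F)
      (Submodule.top_ne_ideal_smul_of_le_jacobson_annihilator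
        (maximalIdeal_le_jacobson _)).symm.lt_top).out 1 3
    exact key.mpr
      ⟨rs, hlen.trans hn.symm, hmem, IsRegular.of_isWeaklyRegular_of_mem_maximalIdeal F hmem hF'⟩
      i hi
  obtain ⟨F, _, _, _, _, g, hg⟩ := Module.exists_finite_presentation S M
  have hex := LinearMap.shortExact_shortComplexKer hg
  have : Projective (g.shortComplexKer).X₂ := by
    change Projective (ModuleCat.of S F)
    rw [← IsProjective.iff_projective]; infer_instance
  have hK := (hex.hasProjectiveDimensionLT_X₃_iff 0 this).mp h
  have hK' : Module.Projective S (LinearMap.ker g) := by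
    rw [IsProjective.iff_projective]
    exact projective_iff_hasProjectiveDimensionLT_one.mpr hK
  have : Module.Finite S (ModuleCat.of.{u} S M) := ‹_›
  have key := (ModuleCat.exists_isRegular_tfae (maximalIdeal S) n
    (ModuleCat.of.{u} S M) (Submodule.top_ne_ideal_smul_of_le_jacobson_annihilator
        (maximalIdeal_le_jacobson _)).symm.lt_top).out 1 3
  obtain ⟨rs, hlen, hmem, hrs⟩ := key.mp (fun i hi => by
    have z1 := AddCommGrpCat.isZero_of_iff_subsingleton.mpr (free_ext F i (by omega))
    have z2 := AddCommGrpCat.isZero_of_iff_subsingleton.mpr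
      (free_ext (LinearMap.ker g) (i + 1) (by omega))
    exact AddCommGrpCat.subsingleton_of_isZero <| ShortComplex.Exact.isZero_of_both_zeros
      (Abelian.Ext.covariant_sequence_exact₃' _ hex i (i + 1) rfl)
      (z1.eq_zero_of_src _) (z2.eq_zero_of_tgt _))
  exact ⟨rs, hmem, hrs.toIsWeaklyRegular, hlen⟩

end ProjectiveDimension

/-! ### Maximal Cohen-Macaulay modules over a hypersurface ring -/

section CohenMacaulay
open IsLocalRing RingTheory.Sequence

/-- The existence of a weakly regular sequence of given length in the maximal ideal does not change
under restriction of scalars along a surjective local homomorphism. -/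
theorem RingTheory.Sequence.exists_isWeaklyRegular_iff_of_surjective {A T : Type*} [CommRing A]
    [CommRing T] [IsLocalRing A] [IsLocalRing T] (φ : A →+* T) [IsLocalHom φ]
    (hφ : Function.Surjective φ)
    {X Y : Type*} [AddCommGroup X] [AddCommGroup Y] [Module T X] [Module A Y] (e : Y ≃+ X)
    (he : ∀ (a : A) (y : Y), e (a • y) = φ a • e y) (n : ℕ) :
    (∃ rs : List T, (∀ r ∈ rs, r ∈ maximalIdeal T) ∧ IsWeaklyRegular X rs ∧ rs.length = n) ↔
    (∃ rs : List A, (∀ r ∈ rs, r ∈ maximalIdeal A) ∧ IsWeaklyRegular Y rs ∧ rs.length = n) := by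
  have key (rs : List A) : IsWeaklyRegular Y rs ↔ IsWeaklyRegular X (rs.map φ) :=
    e.isWeaklyRegular_congr (List.forall₂_map_right_iff.mpr (List.forall₂_same.mpr
      fun r _ x => he r x))
  constructor
  · rintro ⟨rs, hmem, hrs, hlen⟩
    obtain ⟨rs, rfl⟩ := List.map_surjective_iff.mpr hφ rs
    refine ⟨rs, fun r hr => ?_, (key rs).mpr hrs, by simpa using hlen⟩
    have := hmem _ (List.mem_map_of_mem hr)
    rw [mem_maximalIdeal, mem_nonunits_iff] at this ⊢
    exact fun hu => this (hu.map φ)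
  · rintro ⟨rs, hmem, hrs, hlen⟩
    refine ⟨rs.map φ, fun r hr => ?_, (key rs).mp hrs, by simpa using hlen⟩
    obtain ⟨a, ha, rfl⟩ := List.mem_map.mp hr
    have := hmem a ha
    rw [mem_maximalIdeal, mem_nonunits_iff] at this ⊢
    exact fun hu => this (isUnit_of_map_unit φ a hu)

variable {R : Type u} [CommRing R]

/-- For a maximal ideal `𝔫` of `R / (f)` with preimage `𝔪` in `R`, the depth condition on `C_𝔫` over
`(R / (f))_𝔫` is equivalent to the one on `C_𝔪` over `R_𝔪`, whose dimension is larger by one. -/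
theorem exists_isWeaklyRegular_localization_quotient_iff [IsNoetherianRing R] {f : R}
    (hf : f ∈ nonZeroDivisors R)
    {C : Type u} [AddCommGroup C] [Module R C] [Module (R ⧸ Ideal.span {f}) C]
    [IsScalarTower R (R ⧸ Ideal.span {f}) C] (n : Ideal (R ⧸ Ideal.span {f})) [n.IsPrime]
    (m : Ideal R) [m.IsPrime] (hmn : m = n.comap (Ideal.Quotient.mk (Ideal.span {f}))) :
    (∃ rs : List (Localization.AtPrime n), (∀ r ∈ rs, r ∈ maximalIdeal (Localization.AtPrime n)) ∧
      IsWeaklyRegular (LocalizedModule n.primeCompl C) rs ∧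
      (rs.length : WithBot ℕ∞) = ringKrullDim (Localization.AtPrime n)) ↔
    (∃ rs : List (Localization.AtPrime m), (∀ r ∈ rs, r ∈ maximalIdeal (Localization.AtPrime m)) ∧
      IsWeaklyRegular (LocalizedModule m.primeCompl C) rs ∧
      ((rs.length + 1 : ℕ) : WithBot ℕ∞) = ringKrullDim (Localization.AtPrime m)) := by
  set q := Ideal.Quotient.mk (Ideal.span {f}) with hq
  have hqs : Function.Surjective q := Ideal.Quotient.mk_surjective
  let φ := Localization.localRingHom m n q hmn
  have hφ : Function.Surjective φ := by
    subst hmn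
    exact RingHom.surjective_localRingHom_of_surjective q hqs n
  have hloc : IsLocalHom φ := Localization.isLocalHom_localRingHom m n q hmn
  have hsub : Submonoid.map q m.primeCompl = n.primeCompl := by
    ext y
    constructor
    · rintro ⟨x, hx, rfl⟩
      exact fun hy => hx (by rw [hmn]; exact hy)
    · intro hy
      obtain ⟨x, rfl⟩ := hqs y
      exact ⟨x, fun hx => hy (by rw [hmn] at hx; exact hx), rfl⟩
  -- the dimension formula
  have hker : RingHom.ker φ = Ideal.span {algebraMap R (Localization.AtPrime m) f} := by
    have := IsLocalization.ker_map (S := Localization.AtPrime m) (Localization.AtPrime n) q hsub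
    have hk : RingHom.ker q = Ideal.span {f} := Ideal.mk_ker
    exact this.trans (by rw [hk, Ideal.map_span, Set.image_singleton])
  have hfm : f ∈ m := by
    rw [hmn, Ideal.mem_comap, hq,
      Ideal.Quotient.eq_zero_iff_mem.mpr (Ideal.mem_span_singleton_self f)]
    exact zero_mem n
  have hdim : ringKrullDim (Localization.AtPrime n) + 1 =
      ringKrullDim (Localization.AtPrime m) := by
    rw [← ringKrullDim_eq_of_ringEquiv (RingHom.quotientKerEquivOfSurjective hφ), hker]
    refine ringKrullDim_quotient_span_singleton_succ_eq_ringKrullDim_of_mem_nonZeroDivisors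
      (IsLocalization.map_nonZeroDivisors_le m.primeCompl _ (Submonoid.mem_map_of_mem _ hf)) ?_
    rwa [← Ideal.mem_comap, ← Ideal.under_def, IsLocalization.AtPrime.under_maximalIdeal _ m]
  -- the isomorphism `C_𝔪 ≃ C_𝔫`
  have h1 : Algebra.algebraMapSubmonoid (R ⧸ Ideal.span {f}) m.primeCompl = n.primeCompl := hsub
  have h2 : IsLocalizedModule (Algebra.algebraMapSubmonoid (R ⧸ Ideal.span {f}) m.primeCompl)
      (LocalizedModule.mkLinearMap n.primeCompl C) := by rw [h1]; infer_instance
  have h3 := IsLocalizedModule.restrictScalars m.primeCompl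
    (LocalizedModule.mkLinearMap n.primeCompl C)
  let : Module (Localization.AtPrime m) (LocalizedModule n.primeCompl C) := Module.compHom _ φ
  have : IsScalarTower R (Localization.AtPrime m) (LocalizedModule n.primeCompl C) :=
    IsScalarTower.of_algebraMap_smul fun r x => by
      change φ (algebraMap R _ r) • x = r • x
      rw [Localization.localRingHom_to_map, algebraMap_smul]
      exact algebraMap_smul (R ⧸ Ideal.span {f}) r x
  let e := (IsLocalizedModule.linearEquiv m.primeCompl (LocalizedModule.mkLinearMap m.primeCompl C)
    ((LocalizedModule.mkLinearMap n.primeCompl C).restrictScalars R)).extendScalarsOfIsLocalization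
      m.primeCompl (Localization.AtPrime m)
  have key := RingTheory.Sequence.exists_isWeaklyRegular_iff_of_surjective φ hφ
    e.toAddEquiv (fun a y => e.map_smul a y)
  have hlen (k : ℕ) : (k : WithBot ℕ∞) = ringKrullDim (Localization.AtPrime n) ↔
      ((k + 1 : ℕ) : WithBot ℕ∞) = ringKrullDim (Localization.AtPrime m) := by
    rw [← hdim, Nat.cast_succ]
    constructor
    · rintro h; rw [h]
    · intro h
      exact le_antisymm (ENat.WithBot.add_le_add_one_right_iff.mp h.le)
        (ENat.WithBot.add_le_add_one_right_iff.mp h.ge)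
  constructor
  · rintro ⟨rs, h1, h2, h3⟩
    obtain ⟨rs', h1', h2', h3'⟩ := (key rs.length).mp ⟨rs, h1, h2, rfl⟩
    exact ⟨rs', h1', h2', (hlen _).mp (h3' ▸ h3)⟩
  · rintro ⟨rs, h1, h2, h3⟩
    obtain ⟨rs', h1', h2', h3'⟩ := (key rs.length).mpr ⟨rs, h1, h2, rfl⟩
    exact ⟨rs', h1', h2', (hlen _).mpr (h3' ▸ h3)⟩

/-- Over a regular ring `R`, the maximal Cohen-Macaulay modules over the hypersurface ring `R / (f)`
are the finitely generated `R / (f)`-modules of projective dimension at most one over `R`. -/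
theorem isMaximalCohenMacaulay_quotient_iff [IsRegularRing R] {f : R}
    (hf : f ∈ nonZeroDivisors R)
    {C : Type u} [AddCommGroup C] [Module R C] [Module (R ⧸ Ideal.span {f}) C]
    [IsScalarTower R (R ⧸ Ideal.span {f}) C] :
    IsMaximalCohenMacaulay (R ⧸ Ideal.span {f}) (ModuleCat.of.{u} _ C) ↔
      Module.Finite R C ∧ HasProjectiveDimensionLE (ModuleCat.of.{u} R C) 1 := by
  have hqs : Function.Surjective (Ideal.Quotient.mk (Ideal.span {f})) :=
    Ideal.Quotient.mk_surjective
  have hfin : Module.Finite (R ⧸ Ideal.span {f}) C ↔ Module.Finite R C :=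
    ⟨fun _ => Module.Finite.trans (R ⧸ Ideal.span {f}) C,
      fun _ => Module.Finite.of_restrictScalars_finite R _ _⟩
  have spanFinrank_eq (m : Ideal R) [m.IsPrime] (k : ℕ) :
      (k : WithBot ℕ∞) = ringKrullDim (Localization.AtPrime m) ↔
        k = (maximalIdeal (Localization.AtPrime m)).spanFinrank := by
    rw [← (IsRegularRing.isRegularLocalRing_localization m).spanFinrank_maximalIdeal]
    norm_cast
  have hpd [Module.Finite R C] (m : Ideal R) [m.IsPrime] :
      HasProjectiveDimensionLE ((ModuleCat.of.{u} R C).localizedModule m.primeCompl) 1 ↔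
      HasProjectiveDimensionLE (ModuleCat.of.{u} (Localization.AtPrime m)
        (LocalizedModule m.primeCompl C)) 1 := by
    let e : ((ModuleCat.of.{u} R C).localizedModule m.primeCompl) ≃ₗ[Localization m.primeCompl]
        (ModuleCat.of.{u} (Localization.AtPrime m) (LocalizedModule m.primeCompl C)) :=
      Shrink.linearEquiv.{u} (Localization m.primeCompl) (LocalizedModule m.primeCompl C)
    exact ⟨fun _ => ModuleCat.hasProjectiveDimensionLE_of_linearEquiv e 1,
      fun _ => ModuleCat.hasProjectiveDimensionLE_of_linearEquiv e.symm 1⟩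
  constructor
  · rintro ⟨h1, h2⟩
    have h1' := hfin.mp h1
    have : Module.Finite R (ModuleCat.of.{u} R C) := h1'
    refine ⟨h1', (ModuleCat.hasProjectiveDimensionLE_iff_forall_maximalSpectrum 1 _).mpr
      fun ⟨m, hm⟩ => (hpd m).mpr ?_⟩
    by_cases hfm : f ∈ m
    · have hle : Ideal.span {f} ≤ m := (Ideal.span_singleton_le_iff_mem m).mpr hfm
      let n := m.map (Ideal.Quotient.mk (Ideal.span {f}))
      have hmn : m = n.comap (Ideal.Quotient.mk (Ideal.span {f})) := by
        rw [Ideal.comap_map_of_surjective _ hqs, ← RingHom.ker_eq_comap_bot, Ideal.mk_ker,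
          sup_eq_left.mpr hle]
      have hn : n.IsMaximal := by
        refine (Ideal.map_eq_top_or_isMaximal_of_surjective _ hqs hm).resolve_left fun h => ?_
        rw [show n = ⊤ from h, Ideal.comap_top] at hmn
        exact hm.ne_top hmn
      obtain ⟨rs, hmem, hrs, hlen⟩ :=
        (exists_isWeaklyRegular_localization_quotient_iff hf n m hmn).mp (h2 n)
      exact IsRegularLocalRing.hasProjectiveDimensionLE_one_of_isWeaklyRegular _ hmem hrs
        ((spanFinrank_eq m _).mp hlen)
    · have hsub : Subsingleton (LocalizedModule m.primeCompl C) := by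
        rw [LocalizedModule.subsingleton_iff]
        intro c
        refine ⟨f, hfm, ?_⟩
        rw [← algebraMap_smul (R ⧸ Ideal.span {f}), Ideal.Quotient.algebraMap_eq,
          Ideal.Quotient.eq_zero_iff_mem.mpr (Ideal.mem_span_singleton_self f), zero_smul]
      have := (ModuleCat.isZero_iff_subsingleton (M := ModuleCat.of (Localization.AtPrime m)
        (LocalizedModule m.primeCompl C))).mpr hsub
      have := this.hasProjectiveDimensionLT_zero
      exact hasProjectiveDimensionLT_of_ge _ 0 2 (by omega)
  · rintro ⟨h1, h2⟩
    refine ⟨hfin.mpr h1, fun n hn => ?_⟩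
    have hm := Ideal.comap_isMaximal_of_surjective _ hqs (K := n)
    refine (exists_isWeaklyRegular_localization_quotient_iff hf n _ rfl).mpr ?_
    set m := n.comap (Ideal.Quotient.mk (Ideal.span {f})) with hmn
    have h3 : HasProjectiveDimensionLE (ModuleCat.of.{u} (Localization.AtPrime m)
        (LocalizedModule m.primeCompl C)) 1 :=
      (hpd m).mp (ModuleCat.localizedModule_hasProjectiveDimensionLE 1 _ _)
    have hfm : f ∈ m := by
      rw [hmn, Ideal.mem_comap,
        Ideal.Quotient.eq_zero_iff_mem.mpr (Ideal.mem_span_singleton_self f)]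
      exact zero_mem n
    have hfm' : algebraMap R (Localization.AtPrime m) f ∈
        maximalIdeal (Localization.AtPrime m) := by
      rwa [← Ideal.mem_comap, ← Ideal.under_def, IsLocalization.AtPrime.under_maximalIdeal _ m]
    have hpos : (maximalIdeal (Localization.AtPrime m)).spanFinrank ≠ 0 := by
      intro h
      have h0 := (Submodule.spanFinrank_eq_zero_iff_eq_bot
        (maximalIdeal _).fg_of_isNoetherianRing).mp h
      rw [h0, Ideal.mem_bot] at hfm'
      have := IsLocalization.map_nonZeroDivisors_le m.primeCompl (Localization.AtPrime m)
        (Submonoid.mem_map_of_mem _ hf)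
      exact nonZeroDivisors.ne_zero this hfm'
    obtain ⟨k, hk⟩ := Nat.exists_eq_succ_of_ne_zero hpos
    obtain ⟨rs, hmem, hrs, hlen⟩ :=
      IsRegularLocalRing.exists_isWeaklyRegular_of_hasProjectiveDimensionLE_one _ h3 hk.symm
    exact ⟨rs, hmem, hrs, (spanFinrank_eq m _).mpr (by rw [hlen, hk])⟩

end CohenMacaulay

/-! ### Injective dimension -/

section InjectiveDimension
open IsLocalRing

variable {R : Type u} [CommRing R]

/-- Baer's criterion for the injective dimension. -/
theorem ModuleCat.hasInjectiveDimensionLE_of_subsingleton_ext_quotient {A : Type u} [Ring A]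
    (n : ℕ) (M : ModuleCat.{u} A)
    (h : ∀ I : Ideal A, Subsingleton (Abelian.Ext (ModuleCat.of.{u} A (A ⧸ I)) M (n + 1))) :
    HasInjectiveDimensionLE M n := by
  induction n generalizing M with
  | zero =>
    rw [HasInjectiveDimensionLE, zero_add, ← injective_iff_hasInjectiveDimensionLT_one]
    suffices Module.Injective A M from Module.injective_object_of_injective_module A M
    rw [← Module.Baer.iff_injective]
    intro I g
    have hex := ModuleCat.shortComplex_shortExact
      (ModuleCat.shortComplexOfCompEqZero I.subtype I.mkQ
        (LinearMap.exact_subtype_mkQ I).linearMap_comp_eq_zero)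
      (LinearMap.exact_subtype_mkQ I) I.subtype_injective I.mkQ_surjective
    obtain ⟨x, hx⟩ := Abelian.Ext.contravariant_sequence_exact₁ hex M
      (Abelian.Ext.mk₀ (ModuleCat.ofHom g)) (add_zero 1) ((h I).elim _ _)
    obtain ⟨g', rfl⟩ := (Abelian.Ext.mk₀_bijective _ _).2 x
    rw [Abelian.Ext.mk₀_comp_mk₀] at hx
    have h2 := (Abelian.Ext.mk₀_bijective _ _).1 hx
    refine ⟨g'.hom, fun x hx => ?_⟩
    have := congrArg (fun k => k.hom ⟨x, hx⟩) h2
    exact this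
  | succ n ih =>
    -- pass to the cokernel of an embedding of `M` into an injective module
    let ⟨J, hJ, i, hi⟩ := EnoughInjectives.presentation M
    have hinj : Function.Injective i.hom := (ModuleCat.mono_iff_injective i).mp hi
    have hex := ModuleCat.shortComplex_shortExact
      (ModuleCat.shortComplexOfCompEqZero _ _ i.hom.exact_map_mkQ_range.linearMap_comp_eq_zero)
      i.hom.exact_map_mkQ_range hinj (Submodule.mkQ_surjective _)
    refine (hex.hasInjectiveDimensionLT_X₃_iff n hJ).mp (ih _ fun I => ?_)
    have z1 := AddCommGrpCat.isZero_of_iff_subsingleton.mpr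
      (HasInjectiveDimensionLT.subsingleton J 1 (n + 1) (by omega)
        (ModuleCat.of.{u} A (A ⧸ I)))
    have z2 := AddCommGrpCat.isZero_of_iff_subsingleton.mpr (h I)
    exact AddCommGrpCat.subsingleton_of_isZero <| ShortComplex.Exact.isZero_of_both_zeros
      (Abelian.Ext.covariant_sequence_exact₃' _ hex (n + 1) (n + 2) rfl)
      (z1.eq_zero_of_src _) (z2.eq_zero_of_tgt _)

/-- Over a regular ring of Krull dimension at most `n`, finitely generated modules have projective
dimension at most `n`. -/
theorem IsRegularRing.hasProjectiveDimensionLE [IsRegularRing R] {n : ℕ}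
    (hn : ringKrullDim R ≤ n) (M : Type u) [AddCommGroup M] [Module R M] [Module.Finite R M] :
    HasProjectiveDimensionLE (ModuleCat.of.{u} R M) n := by
  have : Module.Finite R (ModuleCat.of.{u} R M) := ‹_›
  refine (ModuleCat.hasProjectiveDimensionLE_iff_forall_maximalSpectrum n _).mpr
    fun ⟨m, hm⟩ => ?_
  let e : (ModuleCat.of.{u} (Localization.AtPrime m) (LocalizedModule m.primeCompl M)) ≃ₗ[
      Localization m.primeCompl] ((ModuleCat.of.{u} R M).localizedModule m.primeCompl) :=
    (Shrink.linearEquiv.{u} (Localization m.primeCompl) (LocalizedModule m.primeCompl M)).symm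
  have hk : (maximalIdeal (Localization.AtPrime m)).spanFinrank ≤ n := by
    have h1 := (IsRegularRing.isRegularLocalRing_localization m).spanFinrank_maximalIdeal
    rw [IsLocalization.AtPrime.ringKrullDim_eq_height m] at h1
    have h2 := h1.trans_le ((Ideal.height_le_ringKrullDim_of_ne_top hm.ne_top).trans hn)
    exact_mod_cast h2
  have h3 := IsRegularLocalRing.hasProjectiveDimensionLE (S := Localization.AtPrime m) rfl
    (LocalizedModule m.primeCompl M)
  have h4 : HasProjectiveDimensionLE (ModuleCat.of.{u} (Localization.AtPrime m)
    (LocalizedModule m.primeCompl M)) n := hasProjectiveDimensionLT_of_ge _ _ (n + 1)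
      (Nat.succ_le_succ hk)
  exact ModuleCat.hasProjectiveDimensionLE_of_linearEquiv e n

/-- A regular ring of finite Krull dimension has finite injective dimension over itself. -/
theorem IsRegularRing.exists_hasInjectiveDimensionLE [IsRegularRing R] (h : ringKrullDim R < ⊤) :
    ∃ n : ℕ, HasInjectiveDimensionLE (ModuleCat.of.{u} R R) n := by
  obtain ⟨n, hn⟩ : ∃ n : ℕ, ringKrullDim R ≤ n := by
    generalize ringKrullDim R = d at h
    induction d with
    | bot => exact ⟨0, bot_le⟩
    | coe d =>
      induction d with
      | top => exact absurd h (lt_irrefl _)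
      | coe d => exact ⟨d, le_rfl⟩
  refine ⟨n, ModuleCat.hasInjectiveDimensionLE_of_subsingleton_ext_quotient n _ fun I => ?_⟩
  have := IsRegularRing.hasProjectiveDimensionLE hn (R ⧸ I)
  exact HasProjectiveDimensionLT.subsingleton _ (n + 1) (n + 1) le_rfl _

variable {A : Type u} [Ring A] [Algebra R A]

/-- Coinduction `Hom_R(A, -)` along an algebra `A` that is projective over `R` does not increase the
injective dimension. -/
theorem ModuleCat.hasInjectiveDimensionLE_coextendScalars [Module.Projective R A] (n : ℕ)
    (M : ModuleCat.{u} R) (h : HasInjectiveDimensionLE M n) :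
    HasInjectiveDimensionLE ((ModuleCat.coextendScalars (algebraMap R A)).obj M) n := by
  have hinj (J : ModuleCat.{u} R) [Injective J] :
      Injective ((ModuleCat.coextendScalars (algebraMap R A)).obj J) :=
    Injective.injective_of_adjoint (ModuleCat.restrictCoextendScalarsAdj (algebraMap R A)) J
  induction n generalizing M with
  | zero =>
    rw [HasInjectiveDimensionLE, zero_add, ← injective_iff_hasInjectiveDimensionLT_one] at h ⊢
    exact hinj M
  | succ n ih =>
    let ⟨J, hJ, i, hi⟩ := EnoughInjectives.presentation M
    have hi' : Function.Injective i.hom := (ModuleCat.mono_iff_injective i).mp hi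
    let T : ShortComplex (ModuleCat.{u} R) :=
      ModuleCat.shortComplexOfCompEqZero _ _ i.hom.exact_map_mkQ_range.linearMap_comp_eq_zero
    have hex : T.ShortExact := ModuleCat.shortComplex_shortExact T
      i.hom.exact_map_mkQ_range hi' (Submodule.mkQ_surjective _)
    have hQ := ih T.X₃ ((hex.hasInjectiveDimensionLT_X₃_iff n hJ).mpr h)
    have hT := hex.mono_f
    let G := ModuleCat.coextendScalars.{u, u, u} (algebraMap R A)
    have : G.IsRightAdjoint := (ModuleCat.restrictCoextendScalarsAdj (algebraMap R A)).isRightAdjoint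
    -- `G` is a right adjoint, hence left exact; it is right exact because `A` is projective over `R`.
    have hP : Module.Projective R
        ((ModuleCat.restrictScalars (algebraMap R A)).obj (ModuleCat.of A A)) :=
      Module.Projective.of_equiv
        ({ AddEquiv.refl A with map_smul' := fun r a => Algebra.smul_def r a } :
          A ≃ₗ[R] (ModuleCat.restrictScalars (algebraMap R A)).obj (ModuleCat.of A A))
    have hexG : (T.map G).ShortExact :=
      { exact := hex.exact.map_of_mono_of_preservesKernel G inferInstance inferInstance
        mono_f := inferInstanceAs (Mono (G.map T.f))
        epi_g := (ModuleCat.epi_iff_surjective _).mpr fun y => by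
          obtain ⟨y', hy'⟩ := Module.projective_lifting_property T.g.hom
            (ModuleCat.CoextendScalars.equiv (algebraMap R A) T.X₃ y)
            ((ModuleCat.epi_iff_surjective T.g).mp hex.epi_g)
          exact ⟨(ModuleCat.CoextendScalars.equiv (algebraMap R A) T.X₂).symm y',
            ModuleCat.CoextendScalars.ext hy'⟩ }
    exact (hexG.hasInjectiveDimensionLT_X₃_iff n (hinj J)).mp hQ

/-- If a module `N` over an `R`-algebra `A` that is projective over `R` is isomorphic to
`Hom_R(A, R)` by way of the map `x ↦ (a ↦ t (a x))` for a linear form `t` on `N`, then the injective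
dimension of `N` is at most that of `R`. -/
theorem ModuleCat.hasInjectiveDimensionLE_of_bijective_form [Module.Projective R A]
    (N : Type u) [AddCommGroup N] [Module R N] [Module A N] [IsScalarTower R A N]
    (t : N →ₗ[R] R) (hinj : ∀ x : N, (∀ a : A, t (a • x) = 0) → x = 0)
    (hsurj : ∀ g : A →ₗ[R] R, ∃ x : N, ∀ a : A, t (a • x) = g a) (n : ℕ)
    (h : HasInjectiveDimensionLE (ModuleCat.of.{u} R R) n) :
    HasInjectiveDimensionLE (ModuleCat.of.{u} A N) n := by
  let E := ModuleCat.CoextendScalars.equiv (algebraMap R A) (ModuleCat.of.{u} R R)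
  let ι : A ≃ₗ[R] (ModuleCat.restrictScalars (algebraMap R A)).obj (ModuleCat.of A A) :=
    { AddEquiv.refl A with map_smul' := fun r a => Algebra.smul_def r a }
  let F : N →ₗ[A] (ModuleCat.coextendScalars (algebraMap R A)).obj (ModuleCat.of.{u} R R) :=
    { toFun x := E.symm ((t ∘ₗ (LinearMap.toSpanSingleton A N x).restrictScalars R) ∘ₗ ι.symm)
      map_add' x y := ModuleCat.CoextendScalars.ext (LinearMap.ext fun (a : A) =>
        (congrArg t (smul_add a x y)).trans (map_add t _ _))
      map_smul' b x := ModuleCat.CoextendScalars.ext (LinearMap.ext fun (a : A) =>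
        congrArg t (smul_smul a b x)) }
  have hF : Function.Bijective F := by
    constructor
    · rw [injective_iff_map_eq_zero]
      exact fun x hx => hinj x fun a => LinearMap.congr_fun (congrArg E hx) a
    · intro y
      obtain ⟨x, hx⟩ := hsurj (E y ∘ₗ ι.toLinearMap)
      exact ⟨x, ModuleCat.CoextendScalars.ext (LinearMap.ext hx)⟩
  have := ModuleCat.hasInjectiveDimensionLE_coextendScalars (A := A) n _ h
  exact hasInjectiveDimensionLT_of_iso (LinearEquiv.ofBijective F hF).toModuleIso.symm (n + 1)

end InjectiveDimension

/-! ### A basis of the path algebra and its Frobenius form -/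

noncomputable section
namespace TwoVertex

section PathAlgebra

variable (R : Type u) [CommRing R] (f : R)

theorem ePlus_mul_ePlus : ePlus R f * ePlus R f = ePlus R f := by
  simpa only [gen, map_mul] using quotMap_rel (Rel.ePlus_sq (R := R) (f := f))

theorem eMinus_mul_eMinus : eMinus R f * eMinus R f = eMinus R f := by
  simpa only [gen, map_mul] using quotMap_rel (Rel.eMinus_sq (R := R) (f := f))

theorem arrowU_eq : arrowU R f = ePlus R f * arrowU R f * eMinus R f := by
  simpa only [gen, map_mul] using quotMap_rel (Rel.u_eq (R := R) (f := f))

theorem arrowV_mul_arrowU : arrowV R f * arrowU R f = f • eMinus R f := by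
  simpa only [gen, map_mul, map_smul] using quotMap_rel (Rel.v_mul_u (R := R) (f := f))

theorem ePlus_mul_eMinus : ePlus R f * eMinus R f = 0 := by
  have h := congrArg (ePlus R f * ·) (ePlus_add_eMinus R f)
  simpa only [mul_add, ePlus_mul_ePlus, mul_one, add_eq_left] using h

theorem eMinus_mul_ePlus : eMinus R f * ePlus R f = 0 := by
  have h := congrArg (· * ePlus R f) (ePlus_add_eMinus R f)
  simpa only [add_mul, ePlus_mul_ePlus, one_mul, add_eq_left] using h

theorem ePlus_mul_arrowU : ePlus R f * arrowU R f = arrowU R f := by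
  rw [arrowU_eq, ← mul_assoc, ← mul_assoc, ePlus_mul_ePlus]

theorem arrowU_mul_eMinus : arrowU R f * eMinus R f = arrowU R f := by
  rw [arrowU_eq, mul_assoc, eMinus_mul_eMinus]

theorem eMinus_mul_arrowU : eMinus R f * arrowU R f = 0 := by
  rw [arrowU_eq, ← mul_assoc, ← mul_assoc, eMinus_mul_ePlus, zero_mul, zero_mul]

theorem arrowU_mul_ePlus : arrowU R f * ePlus R f = 0 := by
  rw [arrowU_eq, mul_assoc, eMinus_mul_ePlus, mul_zero]

theorem eMinus_mul_arrowV : eMinus R f * arrowV R f = arrowV R f := by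
  rw [arrowV_eq, ← mul_assoc, ← mul_assoc, eMinus_mul_eMinus]

theorem arrowV_mul_ePlus : arrowV R f * ePlus R f = arrowV R f := by
  rw [arrowV_eq, mul_assoc, ePlus_mul_ePlus]

theorem ePlus_mul_arrowV : ePlus R f * arrowV R f = 0 := by
  rw [arrowV_eq, ← mul_assoc, ← mul_assoc, ePlus_mul_eMinus, zero_mul, zero_mul]

theorem arrowV_mul_eMinus : arrowV R f * eMinus R f = 0 := by
  rw [arrowV_eq, mul_assoc, ePlus_mul_eMinus, mul_zero]

theorem arrowU_mul_arrowU : arrowU R f * arrowU R f = 0 := by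
  nth_rewrite 1 [← arrowU_mul_eMinus]
  rw [mul_assoc, eMinus_mul_arrowU, mul_zero]

theorem arrowV_mul_arrowV : arrowV R f * arrowV R f = 0 := by
  nth_rewrite 1 [← arrowV_mul_ePlus]
  rw [mul_assoc, ePlus_mul_arrowV, mul_zero]

theorem combination_mul (p q r s p' q' r' s' : R) :
    (p • ePlus R f + q • eMinus R f + r • arrowU R f + s • arrowV R f) *
        (p' • ePlus R f + q' • eMinus R f + r' • arrowU R f + s' • arrowV R f) =
      (p * p' + r * s' * f) • ePlus R f + (q * q' + s * r' * f) • eMinus R f +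
        (p * r' + r * q') • arrowU R f + (q * s' + s * p') • arrowV R f := by
  simp only [mul_add, add_mul, smul_mul_smul_comm, ePlus_mul_ePlus, eMinus_mul_eMinus,
    arrowV_mul_arrowU, arrowU_mul_arrowV, ePlus_mul_eMinus, eMinus_mul_ePlus, ePlus_mul_arrowU,
    arrowU_mul_eMinus, eMinus_mul_arrowU, arrowU_mul_ePlus, eMinus_mul_arrowV, arrowV_mul_ePlus,
    ePlus_mul_arrowV, arrowV_mul_eMinus, arrowU_mul_arrowU, arrowV_mul_arrowV, smul_zero,
    smul_smul, add_smul]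
  abel

theorem quotMap_surjective : Function.Surjective (quotMap R f) :=
  RingQuot.mkAlgHom_surjective R (Rel R f)

/-- The elements `e₊, e₋, u, v` span `B` over `R`. -/
theorem exists_eq_combination (b : B R f) : ∃ p q r s : R,
    b = p • ePlus R f + q • eMinus R f + r • arrowU R f + s • arrowV R f := by
  obtain ⟨x, rfl⟩ := quotMap_surjective R f b
  induction x using FreeAlgebra.induction with
  | grade0 r =>
    refine ⟨r, r, 0, 0, ?_⟩
    rw [AlgHom.commutes, zero_smul, zero_smul, add_zero, add_zero, ← smul_add, ePlus_add_eMinus,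
      Algebra.algebraMap_eq_smul_one]
  | grade1 x =>
    cases x with
    | ePlus => exact ⟨1, 0, 0, 0, by simp [gen]⟩
    | eMinus => exact ⟨0, 1, 0, 0, by simp [gen]⟩
    | u => exact ⟨0, 0, 1, 0, by simp [gen]⟩
    | v => exact ⟨0, 0, 0, 1, by simp [gen]⟩
  | mul x y hx hy =>
    obtain ⟨p, q, r, s, hx⟩ := hx
    obtain ⟨p', q', r', s', hy⟩ := hy
    refine ⟨p * p' + r * s' * f, q * q' + s * r' * f, p * r' + r * q', q * s' + s * p', ?_⟩
    rw [map_mul, hx, hy, combination_mul]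
  | add x y hx hy =>
    obtain ⟨p, q, r, s, hx⟩ := hx
    obtain ⟨p', q', r', s', hy⟩ := hy
    refine ⟨p + p', q + q', r + r', s + s', ?_⟩
    rw [map_add, hx, hy]
    simp only [add_smul]
    abel

/-- The images of the generators under the representation `matrixRep`. -/
def genMatrix : Gen → Matrix (Fin 2) (Fin 2) R × Matrix (Fin 2) (Fin 2) R
  | Gen.ePlus => (!![1, 0; 0, 0], !![1, 0; 0, 0])
  | Gen.eMinus => (!![0, 0; 0, 1], !![0, 0; 0, 1])
  | Gen.u => (!![0, 1; 0, 0], !![0, f; 0, 0])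
  | Gen.v => (!![0, 0; f, 0], !![0, 0; 1, 0])

/-- A faithful representation of `B` by pairs of `2 × 2` matrices: the arrows `u`, `v` act by the
matrix units `E₁₂`, `f E₂₁` in the first component and by `f E₁₂`, `E₂₁` in the second one. -/
def matrixRep : B R f →ₐ[R] Matrix (Fin 2) (Fin 2) R × Matrix (Fin 2) (Fin 2) R :=
  RingQuot.liftAlgHom R ⟨FreeAlgebra.lift R (genMatrix R f), fun x y h => by
    cases h <;>
      simp only [map_mul, map_add, map_one, map_smul, FreeAlgebra.lift_ι_apply, genMatrix] <;>
      ext i j <;> fin_cases i <;> fin_cases j <;> simp⟩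

theorem matrixRep_gen (x : Gen) : matrixRep R f (gen R f x) = genMatrix R f x := by
  rw [matrixRep, gen, quotMap]
  exact (RingQuot.liftAlgHom_mkAlgHom_apply R _ _ _).trans (FreeAlgebra.lift_ι_apply _ _)

/-- The coordinates of an element of `B` with respect to `e₊, e₋, u, v`. -/
def coords : B R f ≃ₗ[R] R × R × R × R := by
  refine LinearEquiv.symm (LinearEquiv.ofBijective
    { toFun x := x.1 • ePlus R f + x.2.1 • eMinus R f + x.2.2.1 • arrowU R f + x.2.2.2 • arrowV R f
      map_add' x y := by simp only [Prod.fst_add, Prod.snd_add, add_smul]; abel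
      map_smul' r x := by
        simp only [Prod.smul_fst, Prod.smul_snd, smul_eq_mul, mul_smul, smul_add,
          RingHom.id_apply] } ⟨?_, ?_⟩)
  · rw [injective_iff_map_eq_zero]
    rintro ⟨p, q, r, s⟩ h
    have h1 : matrixRep R f
      (p • ePlus R f + q • eMinus R f + r • arrowU R f + s • arrowV R f) = 0 :=
        (congrArg (matrixRep R f) h).trans (map_zero _)
    simp only [map_add, map_smul, matrixRep_gen, genMatrix] at h1
    have h2 := congrArg Prod.fst h1
    have h3 := congrArg Prod.snd h1
    have hp := congrFun (congrFun h2 0) 0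
    have hq := congrFun (congrFun h2 1) 1
    have hr := congrFun (congrFun h2 0) 1
    have hs := congrFun (congrFun h3 1) 0
    simp at hp hq hr hs
    simp [hp, hq, hr, hs]
  · intro b
    obtain ⟨p, q, r, s, h⟩ := exists_eq_combination R f b
    exact ⟨(p, q, r, s), h.symm⟩

theorem coords_symm_apply (p q r s : R) : (coords R f).symm (p, q, r, s) =
    p • ePlus R f + q • eMinus R f + r • arrowU R f + s • arrowV R f := rfl

theorem coords_combination (p q r s : R) :
    coords R f (p • ePlus R f + q • eMinus R f + r • arrowU R f + s • arrowV R f) =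
      (p, q, r, s) := by
  rw [← coords_symm_apply, LinearEquiv.apply_symm_apply]

instance : Module.Free R (B R f) := Module.Free.of_equiv (coords R f).symm

instance : Module.Finite R (B R f) := Module.Finite.equiv (coords R f).symm

/-- The linear form on `B` that sends `p e₊ + q e₋ + r u + s v` to `r + s`. -/
def frobeniusForm : B R f →ₗ[R] R :=
  (LinearMap.fst R R R + LinearMap.snd R R R) ∘ₗ LinearMap.snd R R (R × R) ∘ₗ
    LinearMap.snd R R (R × R × R) ∘ₗ (coords R f).toLinearMap

theorem frobeniusForm_combination (p q r s : R) :
    frobeniusForm R f (p • ePlus R f + q • eMinus R f + r • arrowU R f + s • arrowV R f) =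
      r + s := by
  simp [frobeniusForm, coords_combination]

/-- The form `(a, b) ↦ t (a b)` on `B` that is attached to the linear form `t = frobeniusForm` is
perfect: the basis `e₊, e₋, u, v` has the dual bases `u, v, e₋, e₊` and `v, u, e₊, e₋`. -/
theorem frobeniusForm_combination_mul (p q r s p' q' r' s' : R) :
    frobeniusForm R f
      ((p • ePlus R f + q • eMinus R f + r • arrowU R f + s • arrowV R f) *
        (p' • ePlus R f + q' • eMinus R f + r' • arrowU R f + s' • arrowV R f)) =
      p * r' + r * q' + q * s' + s * p' := by
  rw [combination_mul, frobeniusForm_combination, add_assoc, add_assoc, add_assoc]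

/-- If a regular ring `R` has finite Krull dimension, then `B` is Iwanaga-Gorenstein, because `B` is
isomorphic to `Hom_R(B, R)` as a left and as a right module. -/
theorem isIwanagaGorenstein [IsRegularRing R] (h : ringKrullDim R < ⊤) :
    IsIwanagaGorenstein (B R f) := by
  obtain ⟨n, hn⟩ := IsRegularRing.exists_hasInjectiveDimensionLE h
  have hop : Module.Projective R (B R f)ᵐᵒᵖ :=
    Module.Projective.of_equiv (MulOpposite.opLinearEquiv R (M := B R f))
  refine ⟨isNoetherian_of_tower R inferInstance, isNoetherian_of_tower R inferInstance,
    ⟨n, ?_⟩, ⟨n, ?_⟩⟩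
  · refine ModuleCat.hasInjectiveDimensionLE_of_bijective_form (B R f) (frobeniusForm R f)
      (fun x hx => ?_) (fun g => ?_) n hn
    · obtain ⟨p, q, r, s, rfl⟩ := exists_eq_combination R f x
      have h0 (p' q' r' s' : R) : p' * r + r' * q + q' * s + s' * p = 0 :=
        (frobeniusForm_combination_mul R f p' q' r' s' p q r s).symm.trans (hx _)
      have h1 := h0 1 0 0 0
      have h2 := h0 0 1 0 0
      have h3 := h0 0 0 1 0
      have h4 := h0 0 0 0 1
      simp only [one_mul, zero_mul, add_zero, zero_add] at h1 h2 h3 h4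
      simp [h1, h2, h3, h4]
    · refine ⟨g (arrowV R f) • ePlus R f + g (arrowU R f) • eMinus R f +
        g (ePlus R f) • arrowU R f + g (eMinus R f) • arrowV R f, fun a => ?_⟩
      obtain ⟨p, q, r, s, rfl⟩ := exists_eq_combination R f a
      rw [smul_eq_mul, frobeniusForm_combination_mul]
      simp only [map_add, map_smul, smul_eq_mul]
      ring
  · refine ModuleCat.hasInjectiveDimensionLE_of_bijective_form (A := (B R f)ᵐᵒᵖ) (B R f)
      (frobeniusForm R f) (fun x hx => ?_) (fun g => ?_) n hn
    · obtain ⟨p, q, r, s, rfl⟩ := exists_eq_combination R f x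
      have h0 (p' q' r' s' : R) : p * r' + r * q' + q * s' + s * p' = 0 :=
        (frobeniusForm_combination_mul R f p q r s p' q' r' s').symm.trans
          (hx (MulOpposite.op _))
      have h1 := h0 1 0 0 0
      have h2 := h0 0 1 0 0
      have h3 := h0 0 0 1 0
      have h4 := h0 0 0 0 1
      simp only [mul_one, mul_zero, add_zero, zero_add] at h1 h2 h3 h4
      simp [h1, h2, h3, h4]
    · let g' : B R f →ₗ[R] R := g ∘ₗ (MulOpposite.opLinearEquiv R (M := B R f)).toLinearMap
      refine ⟨g' (arrowU R f) • ePlus R f + g' (arrowV R f) • eMinus R f +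
        g' (eMinus R f) • arrowU R f + g' (ePlus R f) • arrowV R f, fun a => ?_⟩
      obtain ⟨p, q, r, s, ha⟩ := exists_eq_combination R f a.unop
      have hg : g a = g' a.unop := rfl
      change frobeniusForm R f (_ * a.unop) = _
      rw [hg, ha, frobeniusForm_combination_mul]
      simp only [map_add, map_smul, smul_eq_mul]
      ring

end PathAlgebra

end TwoVertex
end

noncomputable section
namespace TwoVertex

section RightModules

open scoped RightActions

variable {R : Type u} [CommRing R] {f : R}

/-! ### Right modules over `B` -/

theorem act_act (M : RMod R f) (m : M) (a b : B R f) : m <• a <• b = m <• (a * b) :=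
  smul_smul _ _ m

theorem act_add (M : RMod R f) (m : M) (a b : B R f) : m <• (a + b) = m <• a + m <• b := by
  rw [MulOpposite.op_add, add_smul]

theorem act_smul (M : RMod R f) (m : M) (r : R) (b : B R f) : m <• (r • b) = r • (m <• b) := by
  rw [MulOpposite.op_smul, smul_assoc]

theorem act_zero (M : RMod R f) (m : M) : m <• (0 : B R f) = 0 := by
  rw [MulOpposite.op_zero, zero_smul]

theorem smul_act (M : RMod R f) (m : M) (r : R) (b : B R f) : (r • m) <• b = r • (m <• b) :=
  smul_comm _ _ _

theorem act_ePlus_add_act_eMinus (M : RMod R f) (m : M) :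
    m <• ePlus R f + m <• eMinus R f = m := by
  rw [← act_add, ePlus_add_eMinus, MulOpposite.op_one, one_smul]

theorem act_combination (M : RMod R f) (m : M) (p q r s : R) :
    m <• (p • ePlus R f + q • eMinus R f + r • arrowU R f + s • arrowV R f) =
      p • (m <• ePlus R f) + q • (m <• eMinus R f) + r • (m <• arrowU R f) +
        s • (m <• arrowV R f) := by
  simp only [act_add, act_smul]

/-- The component `M₋ = M e₋` of a right `B`-module. -/
def minusPart (M : RMod R f) : Submodule R M :=
  LinearMap.range (Algebra.lsmul R R M (MulOpposite.op (eMinus R f)))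

theorem act_ePlus_mem (M : RMod R f) (m : M) : m <• ePlus R f ∈ plusPart M := ⟨m, rfl⟩

theorem act_eMinus_mem (M : RMod R f) (m : M) : m <• eMinus R f ∈ minusPart M := ⟨m, rfl⟩

theorem act_ePlus_eq_self {M : RMod R f} {m : M} (hm : m ∈ plusPart M) : m <• ePlus R f = m := by
  obtain ⟨m, rfl⟩ := hm
  exact (act_act M m _ _).trans (by rw [ePlus_mul_ePlus]; rfl)

theorem act_eMinus_eq_self {M : RMod R f} {m : M} (hm : m ∈ minusPart M) :
    m <• eMinus R f = m := by
  obtain ⟨m, rfl⟩ := hm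
  exact (act_act M m _ _).trans (by rw [eMinus_mul_eMinus]; rfl)

theorem act_eMinus_eq_zero {M : RMod R f} {m : M} (hm : m ∈ plusPart M) :
    m <• eMinus R f = 0 := by
  rw [← act_ePlus_eq_self hm, act_act, ePlus_mul_eMinus, act_zero]

theorem act_ePlus_eq_zero {M : RMod R f} {m : M} (hm : m ∈ minusPart M) :
    m <• ePlus R f = 0 := by
  rw [← act_eMinus_eq_self hm, act_act, eMinus_mul_ePlus, act_zero]

theorem act_arrowV_mem (M : RMod R f) (m : M) : m <• arrowV R f ∈ plusPart M := by
  rw [← arrowV_mul_ePlus, ← act_act]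
  exact act_ePlus_mem M _

theorem act_arrowU_mem (M : RMod R f) (m : M) : m <• arrowU R f ∈ minusPart M := by
  rw [← arrowU_mul_eMinus, ← act_act]
  exact act_eMinus_mem M _

theorem act_eMinus_act_arrowV (M : RMod R f) (m : M) :
    m <• eMinus R f <• arrowV R f = m <• arrowV R f := by
  rw [act_act, eMinus_mul_arrowV]

/-- If `f` is regular on `M`, then `v` acts injectively on `M₋`, because `v u = f e₋`. -/
theorem eq_of_act_arrowV_eq {M : RMod R f} (hf : IsSMulRegular M f) {m m' : M}
    (hm : m ∈ minusPart M) (hm' : m' ∈ minusPart M) (h : m <• arrowV R f = m' <• arrowV R f) :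
    m = m' := by
  have h1 := congrArg (· <• arrowU R f) h
  simp only [act_act, arrowV_mul_arrowU, act_smul, act_eMinus_eq_self hm,
    act_eMinus_eq_self hm'] at h1
  exact hf h1

/-- An `R`-linear map between right `B`-modules that commutes with the generators of `B` is
`B`-linear. -/
theorem map_act_of_gen {M N : RMod R f} (g : M →ₗ[R] N)
    (hp : ∀ m, g (m <• ePlus R f) = g m <• ePlus R f)
    (hq : ∀ m, g (m <• eMinus R f) = g m <• eMinus R f)
    (hu : ∀ m, g (m <• arrowU R f) = g m <• arrowU R f)
    (hv : ∀ m, g (m <• arrowV R f) = g m <• arrowV R f) (b : B R f) (m : M) :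
    g (m <• b) = g m <• b := by
  obtain ⟨p, q, r, s, rfl⟩ := exists_eq_combination R f b
  simp only [act_combination, map_add, map_smul, hp, hq, hu, hv]

/-- The decomposition `M = M₊ ⊕ M₋`. -/
def partsEquiv (M : RMod R f) : M ≃ₗ[R] plusPart M × minusPart M where
  toFun m := (⟨m <• ePlus R f, act_ePlus_mem M m⟩, ⟨m <• eMinus R f, act_eMinus_mem M m⟩)
  map_add' m m' := by ext <;> simp [smul_add]
  map_smul' r m := by ext <;> simp [smul_act]
  invFun x := x.1 + x.2
  left_inv m := act_ePlus_add_act_eMinus M m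
  right_inv x := by
    ext
    · simp only [smul_add, act_ePlus_eq_self x.1.2, act_ePlus_eq_zero x.2.2, add_zero]
    · simp only [smul_add, act_eMinus_eq_self x.2.2, act_eMinus_eq_zero x.1.2, zero_add]

theorem isCM_iff (M : RMod R f) : IsCM M ↔
    (Module.Finite R (plusPart M) ∧ Module.Projective R (plusPart M)) ∧
      (Module.Finite R (minusPart M) ∧ Module.Projective R (minusPart M)) := by
  constructor
  · rintro ⟨_, _⟩
    have h1 : Module.Projective R (plusPart M × minusPart M) :=
      Module.Projective.of_equiv (partsEquiv M)
    have h2 : Module.Finite R (plusPart M × minusPart M) := Module.Finite.equiv (partsEquiv M)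
    exact ⟨⟨Module.Finite.of_surjective _ (LinearMap.fst_surjective (M := plusPart M)
        (M₂ := minusPart M)),
      Module.Projective.of_split (LinearMap.inl R (plusPart M) (minusPart M))
        (LinearMap.fst R (plusPart M) (minusPart M)) (by ext; rfl)⟩,
      ⟨Module.Finite.of_surjective _ (LinearMap.snd_surjective (M := plusPart M)
        (M₂ := minusPart M)),
      Module.Projective.of_split (LinearMap.inr R (plusPart M) (minusPart M))
        (LinearMap.snd R (plusPart M) (minusPart M)) (by ext; rfl)⟩⟩
  · rintro ⟨⟨_, _⟩, ⟨_, _⟩⟩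
    exact ⟨Module.Finite.equiv (partsEquiv M).symm, Module.Projective.of_equiv (partsEquiv M).symm⟩

theorem IsCM.isSMulRegular (hf : f ∈ nonZeroDivisors R) {M : RMod R f} (hM : IsCM M) :
    IsSMulRegular M f := by
  have := hM.2
  exact Module.Flat.isSMulRegular_of_nonZeroDivisors hf

/-! ### The functor `i^*` as a cokernel -/

/-- The natural map `m ↦ m ⊗ 1` from `M` to `i^* M = M ⊗_B (B / B e₋ B)`. -/
def toIStar (M : RMod R f) : M →ₗ[R] BalTensor R (Hyp R f) (B R f) (BBar R f) M :=
  (balancedRel R (Hyp R f) (B R f) (BBar R f) M).mkQ.restrictScalars R ∘ₗ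
    TensorProduct.mk R (BBar R f) M 1

theorem toIStar_act (M : RMod R f) (m : M) (b : B R f) :
    toIStar M (m <• b) = Submodule.Quotient.mk (Ideal.Quotient.mk (idealMinus R f) b ⊗ₜ[R] m) := by
  have h : (b • (1 : BBar R f)) ⊗ₜ[R] m - (1 : BBar R f) ⊗ₜ[R] (m <• b) ∈
      balancedRel R (Hyp R f) (B R f) (BBar R f) M := Submodule.subset_span ⟨b, 1, m, rfl⟩
  have h1 : b • (1 : BBar R f) = Ideal.Quotient.mk (idealMinus R f) b :=
    congrArg (Ideal.Quotient.mk (idealMinus R f)) (mul_one b)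
  rw [h1] at h
  exact ((Submodule.Quotient.eq _).mpr h).symm

theorem toIStar_surjective (M : RMod R f) : Function.Surjective (toIStar M) := by
  intro y
  obtain ⟨t, rfl⟩ := Submodule.Quotient.mk_surjective _ y
  induction t using TensorProduct.induction_on with
  | zero => exact ⟨0, map_zero _⟩
  | tmul b m =>
    obtain ⟨b, rfl⟩ := Ideal.Quotient.mk_surjective b
    exact ⟨m <• b, toIStar_act M m b⟩
  | add x y hx hy =>
    obtain ⟨m, hm⟩ := hx
    obtain ⟨m', hm'⟩ := hy
    exact ⟨m + m', by rw [map_add, hm, hm', Submodule.Quotient.mk_add]⟩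

theorem eMinus_mem_idealMinus : eMinus R f ∈ idealMinus R f := by
  rw [idealMinus, TwoSidedIdeal.mem_asIdeal]
  exact TwoSidedIdeal.subset_span rfl

theorem toIStar_act_eq_zero (M : RMod R f) (m : M) {b : B R f} (hb : b ∈ idealMinus R f) :
    toIStar M (m <• b) = 0 := by
  rw [toIStar_act, Ideal.Quotient.eq_zero_iff_mem.mpr hb, TensorProduct.zero_tmul,
    Submodule.Quotient.mk_zero]

/-- The `B`-submodule `M e₋ B` of `M`, which is the sum of `M₋` and of the image of `v`. -/
def kerSubmodule (M : RMod R f) : Submodule (B R f)ᵐᵒᵖ M where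
  carrier := {m | ∃ y : M, m <• ePlus R f = y <• arrowV R f}
  zero_mem' := ⟨0, by rw [smul_zero, smul_zero]⟩
  add_mem' := by
    rintro m m' ⟨y, hy⟩ ⟨y', hy'⟩
    exact ⟨y + y', by rw [smul_add, smul_add, hy, hy']⟩
  smul_mem' := by
    rintro b m ⟨y, hy⟩
    obtain ⟨p, q, r, s, hb⟩ := exists_eq_combination R f b.unop
    refine ⟨p • y + s • m, ?_⟩
    rw [← MulOpposite.op_unop b, hb, act_combination]
    simp only [smul_add, smul_act, act_act, eMinus_mul_ePlus, arrowU_mul_ePlus, arrowV_mul_ePlus,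
      act_zero, smul_zero, add_zero, hy]

/-- The kernel of `M → i^* M` is `M e₋ B`; it consists of the `m` with `m e₊ ∈ M₋ v`. The element `y`
need not be taken from `M₋`, because `y v = y e₋ v`. -/
theorem toIStar_eq_zero_iff (M : RMod R f) (m : M) :
    toIStar M m = 0 ↔ ∃ y : M, m <• ePlus R f = y <• arrowV R f := by
  constructor
  · intro h
    -- `b ⊗ m ↦ m b` defines a left inverse of the map `M / M e₋ B → i^* M`
    let Q := M ⧸ kerSubmodule M
    let α : B R f →ₐ[R] (Module.End R Q)ᵐᵒᵖ := AlgHom.opComm.symm (Algebra.lsmul R R Q)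
    have hα : ∀ b ∈ idealMinus R f, α b = 0 := by
      have hle : TwoSidedIdeal.span {eMinus R f} ≤ TwoSidedIdeal.ker α := by
        refine TwoSidedIdeal.span_le.mpr (Set.singleton_subset_iff.mpr ?_)
        refine (TwoSidedIdeal.mem_ker α).mpr (MulOpposite.unop_injective (LinearMap.ext fun x => ?_))
        obtain ⟨m, rfl⟩ := (kerSubmodule M).mkQ_surjective x
        refine (Submodule.Quotient.mk_eq_zero _).mpr ⟨0, (act_act M m _ _).trans ?_⟩
        rw [eMinus_mul_ePlus, act_zero, smul_zero]
      exact fun b hb => (TwoSidedIdeal.mem_ker α).mp (hle hb)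
    let α' : BBar R f →ₐ[R] (Module.End R Q)ᵐᵒᵖ := Ideal.Quotient.liftₐ (idealMinus R f) α hα
    let Φ : BBar R f ⊗[R] M →ₗ[R] Q := TensorProduct.lift
      (LinearMap.lcomp R Q ((kerSubmodule M).mkQ.restrictScalars R) ∘ₗ
        (MulOpposite.opLinearEquiv R).symm.toLinearMap ∘ₗ α'.toLinearMap)
    have hΦ (b : B R f) (x : M) : Φ (Ideal.Quotient.mk (idealMinus R f) b ⊗ₜ[R] x) =
      (kerSubmodule M).mkQ (x <• b) := rfl
    have h0 : ∀ t ∈ balancedRel R (Hyp R f) (B R f) (BBar R f) M, Φ t = 0 := by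
      intro t ht
      induction ht using Submodule.span_induction with
      | mem t ht =>
        obtain ⟨b, x, m, rfl⟩ := ht
        obtain ⟨x, rfl⟩ := Ideal.Quotient.mk_surjective x
        have h1 : b • Ideal.Quotient.mk (idealMinus R f) x =
          Ideal.Quotient.mk (idealMinus R f) (b * x) := rfl
        rw [map_sub, h1, hΦ, hΦ, act_act, sub_self]
      | zero => exact map_zero _
      | add x y _ _ hx hy => rw [map_add, hx, hy, add_zero]
      | smul c x _ hx =>
        obtain ⟨r, rfl⟩ := Ideal.Quotient.mk_surjective c
        have h1 : Ideal.Quotient.mk (Ideal.span {f}) r • x = r • x := algebraMap_smul _ r x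
        rw [h1, map_smul, hx, smul_zero]
    have h1 := h0 _ ((Submodule.Quotient.mk_eq_zero _).mp h)
    have h2 := (hΦ 1 m).symm.trans h1
    rw [MulOpposite.op_one, one_smul] at h2
    exact (Submodule.Quotient.mk_eq_zero _).mp h2
  · rintro ⟨y, hy⟩
    have hv : arrowV R f ∈ idealMinus R f := by
      rw [← eMinus_mul_arrowV]
      exact Ideal.mul_mem_right _ _ eMinus_mem_idealMinus
    rw [← act_ePlus_add_act_eMinus M m, hy, map_add, toIStar_act_eq_zero M y hv,
      toIStar_act_eq_zero M m eMinus_mem_idealMinus, add_zero]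

theorem toIStar_act_ePlus (M : RMod R f) (m : M) : toIStar M (m <• ePlus R f) = toIStar M m := by
  conv_rhs => rw [← act_ePlus_add_act_eMinus M m]
  rw [map_add, toIStar_act_eq_zero M m eMinus_mem_idealMinus, add_zero]

end RightModules

end TwoVertex
end

noncomputable section
namespace TwoVertex

section MatrixFactorizations

/-! ### `i^*` and maximal Cohen-Macaulay modules -/


open scoped RightActions

variable {R : Type u} [CommRing R] {f : R}

/-- The map `v : M₋ → M₊`. -/
def arrowVMap (M : RMod R f) : minusPart M →ₗ[R] plusPart M :=
  (Algebra.lsmul R R M (MulOpposite.op (arrowV R f))).restrict fun m _ => act_arrowV_mem M m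

/-- The natural map `M₊ → i^* M`. -/
def plusToIStar (M : RMod R f) : plusPart M →ₗ[R] BalTensor R (Hyp R f) (B R f) (BBar R f) M :=
  toIStar M ∘ₗ (plusPart M).subtype

theorem plusToIStar_surjective (M : RMod R f) : Function.Surjective (plusToIStar M) := by
  intro y
  obtain ⟨m, rfl⟩ := toIStar_surjective M y
  exact ⟨⟨_, act_ePlus_mem M m⟩, toIStar_act_ePlus M m⟩

/-- `i^* M` is the cokernel of `v : M₋ → M₊`. -/
theorem exact_arrowVMap_plusToIStar (M : RMod R f) :
    Function.Exact (arrowVMap M) (plusToIStar M) := by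
  rintro ⟨x, hx⟩
  refine (toIStar_eq_zero_iff M x).trans ?_
  rw [act_ePlus_eq_self hx]
  constructor
  · rintro ⟨y, hy⟩
    exact ⟨⟨_, act_eMinus_mem M y⟩, Subtype.ext ((act_eMinus_act_arrowV M y).trans hy.symm)⟩
  · rintro ⟨y, hy⟩
    exact ⟨y, (congrArg Subtype.val hy).symm⟩

/-- Together with `exact_arrowVMap_plusToIStar`: if `f` is regular on `M`, then
`0 → M₋ → M₊ → i^* M → 0` is exact. -/
theorem arrowVMap_injective {M : RMod R f} (hf : IsSMulRegular M f) :
    Function.Injective (arrowVMap M) := fun y y' h =>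
  Subtype.ext (eq_of_act_arrowV_eq hf y.2 y'.2 (congrArg Subtype.val h))

/-- Membership in `CM(B)` is detected by `i^*` among the modules `M` on which `f` is regular and
whose component `M₊` is finitely generated projective over `R`. -/
theorem isCM_iff_isMaximalCohenMacaulay [IsRegularRing R] (hf : f ∈ nonZeroDivisors R)
    (M : RMod R f) (h1 : Module.Finite R (plusPart M)) (h2 : Module.Projective R (plusPart M))
    (h3 : IsSMulRegular M f) :
    IsCM M ↔ IsMaximalCohenMacaulay (Hyp R f) ((iStar R f).obj M) := by
  have hex := ModuleCat.shortComplex_shortExact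
    (ModuleCat.shortComplexOfCompEqZero (arrowVMap M) (plusToIStar M)
      (exact_arrowVMap_plusToIStar M).linearMap_comp_eq_zero)
    (exact_arrowVMap_plusToIStar M) (arrowVMap_injective h3) (plusToIStar_surjective M)
  have hP := (IsProjective.iff_projective (R := R) (plusPart M)).mp h2
  have h4 : HasProjectiveDimensionLE
        (ModuleCat.of.{u} R (BalTensor R (Hyp R f) (B R f) (BBar R f) M)) 1 ↔
      Module.Projective R (minusPart M) :=
    (hex.hasProjectiveDimensionLT_X₃_iff 0 hP).trans
      (projective_iff_hasProjectiveDimensionLT_one.symm.trans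
        (IsProjective.iff_projective (R := R) (minusPart M)).symm)
  have h5 : Module.Finite R (minusPart M) := Module.Finite.of_injective _ (arrowVMap_injective h3)
  have h6 : Module.Finite R (BalTensor R (Hyp R f) (B R f) (BBar R f) M) :=
    Module.Finite.of_surjective _ (plusToIStar_surjective M)
  refine (isCM_iff M).trans (Iff.trans ?_ (isMaximalCohenMacaulay_quotient_iff hf).symm)
  rw [h4]
  exact ⟨fun h => ⟨h6, h.2.2⟩, fun h => ⟨⟨h1, h2⟩, ⟨h5, h.2⟩⟩⟩

theorem isMaximalCohenMacaulay_iStar [IsRegularRing R] (hf : f ∈ nonZeroDivisors R)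
    {M : RMod R f} (hM : IsCM M) : IsMaximalCohenMacaulay (Hyp R f) ((iStar R f).obj M) := by
  have h := ((isCM_iff M).mp hM).1
  exact (isCM_iff_isMaximalCohenMacaulay hf M h.1 h.2 (hM.isSMulRegular hf)).mp hM

/-- Invariance under isomorphism, which is immediate for the characterization by the projective
dimension over `R`. -/
theorem _root_.isMaximalCohenMacaulay_quotient_of_linearEquiv [IsRegularRing R]
    (hf : f ∈ nonZeroDivisors R) {C D : ModuleCat.{u} (Hyp R f)} (e : C ≃ₗ[Hyp R f] D)
    (hC : IsMaximalCohenMacaulay (Hyp R f) C) : IsMaximalCohenMacaulay (Hyp R f) D := by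
  let : Module R C := Module.compHom C (algebraMap R (Hyp R f))
  have : IsScalarTower R (Hyp R f) C := IsScalarTower.of_algebraMap_smul fun _ _ => rfl
  let : Module R D := Module.compHom D (algebraMap R (Hyp R f))
  have : IsScalarTower R (Hyp R f) D := IsScalarTower.of_algebraMap_smul fun _ _ => rfl
  obtain ⟨h1, h2⟩ := (isMaximalCohenMacaulay_quotient_iff hf (C := C)).mp hC
  have e' : (ModuleCat.of.{u} R C) ≃ₗ[R] (ModuleCat.of.{u} R D) := e.restrictScalars R
  exact (isMaximalCohenMacaulay_quotient_iff hf (C := D)).mpr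
    ⟨Module.Finite.equiv e', ModuleCat.hasProjectiveDimensionLE_of_linearEquiv e' 1⟩

/-! ### The right module of a factorization -/

section OfArrows

variable {P K : Type u} [AddCommGroup P] [Module R P] [AddCommGroup K] [Module R K]
  (α : P →ₗ[R] K) (β : K →ₗ[R] P)

/-- The action of the generators on `P × K` that is given by maps `α : P → K` and `β : K → P`. -/
def genEnd : Gen → Module.End R (P × K)
  | Gen.ePlus => LinearMap.inl R P K ∘ₗ LinearMap.fst R P K
  | Gen.eMinus => LinearMap.inr R P K ∘ₗ LinearMap.snd R P K
  | Gen.u => LinearMap.inr R P K ∘ₗ α ∘ₗ LinearMap.fst R P K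
  | Gen.v => LinearMap.inl R P K ∘ₗ β ∘ₗ LinearMap.snd R P K

variable (hβα : ∀ x, β (α x) = f • x) (hαβ : ∀ y, α (β y) = f • y)

/-- The right action of `B` on `P × K` that is given by maps `α : P → K` and `β : K → P` with
`β α = f` and `α β = f`. -/
def arrowsRep : B R f →ₐ[R] (Module.End R (P × K))ᵐᵒᵖ :=
  RingQuot.liftAlgHom R ⟨FreeAlgebra.lift R fun x => MulOpposite.op (genEnd α β x), fun x y h => by
    cases h <;>
      simp only [map_mul, map_add, map_one, map_smul, FreeAlgebra.lift_ι_apply, genEnd] <;>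
      refine MulOpposite.unop_injective (LinearMap.ext fun x => Prod.ext ?_ ?_) <;>
      simp [hβα, hαβ]⟩

theorem arrowsRep_gen (x : Gen) :
    arrowsRep α β hβα hαβ (gen R f x) = MulOpposite.op (genEnd α β x) := by
  rw [arrowsRep, gen, quotMap]
  exact (RingQuot.liftAlgHom_mkAlgHom_apply R _ _ _).trans (FreeAlgebra.lift_ι_apply _ _)

/-- The right `B`-module `M` with `M₊ = P`, `M₋ = K` on which `u` and `v` act by `α : P → K` and
`β : K → P`. -/
def ofArrows : RMod R f :=
  let := Module.compHom (P × K) (AlgHom.opComm (arrowsRep α β hβα hαβ)).toRingHom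
  ModuleCat.of (B R f)ᵐᵒᵖ (P × K)

/-- The underlying `R`-module of `ofArrows` is `P × K`. -/
def ofArrowsEquiv : ofArrows α β hβα hαβ ≃ₗ[R] P × K where
  toFun x := x
  invFun x := x
  left_inv _ := rfl
  right_inv _ := rfl
  map_add' _ _ := rfl
  map_smul' r x := LinearMap.congr_fun
    (congrArg MulOpposite.unop ((arrowsRep α β hβα hαβ).commutes r)) x

theorem ofArrowsEquiv_act_gen (x : ofArrows α β hβα hαβ) (y : Gen) :
    ofArrowsEquiv α β hβα hαβ (x <• gen R f y) =
      genEnd α β y (ofArrowsEquiv α β hβα hαβ x) :=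
  LinearMap.congr_fun (congrArg MulOpposite.unop (arrowsRep_gen α β hβα hαβ y)) x

/-- The component `M₊` of `ofArrows` is `P`. -/
def plusPartOfArrowsEquiv : plusPart (ofArrows α β hβα hαβ) ≃ₗ[R] P where
  toFun x := (ofArrowsEquiv α β hβα hαβ x.1).1
  invFun p := ⟨(ofArrowsEquiv α β hβα hαβ).symm (p, 0),
    (ofArrowsEquiv α β hβα hαβ).symm (p, 0), by
      refine (ofArrowsEquiv α β hβα hαβ).injective ?_
      refine (ofArrowsEquiv_act_gen α β hβα hαβ _ Gen.ePlus).trans ?_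
      rw [LinearEquiv.apply_symm_apply]
      rfl⟩
  left_inv x := by
    refine Subtype.ext ((ofArrowsEquiv α β hβα hαβ).injective ?_)
    conv_rhs => rw [← act_ePlus_eq_self x.2]
    rw [ofArrowsEquiv_act_gen]
    rfl
  right_inv p := rfl
  map_add' _ _ := rfl
  map_smul' r x := by
    rw [Submodule.coe_smul, map_smul]
    rfl

end OfArrows

/-- Every maximal Cohen-Macaulay module over `R / (f)` is of the form `i^* M` with `M` in `CM(B)`:
for a presentation `0 → K → P → C → 0` with `P` free over `R`, take `M₊ = P` and `M₋ = K`, let `v` act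
by the inclusion and `u` by multiplication with `f`. -/
theorem exists_isCM_iStar_iso [IsRegularRing R] (hf : f ∈ nonZeroDivisors R)
    {C : ModuleCat.{u} (Hyp R f)} (hC : IsMaximalCohenMacaulay (Hyp R f) C) :
    ∃ M : RMod R f, IsCM M ∧ Nonempty ((iStar R f).obj M ≅ C) := by
  let : Module R C := Module.compHom C (algebraMap R (Hyp R f))
  have : IsScalarTower R (Hyp R f) C := IsScalarTower.of_algebraMap_smul fun _ _ => rfl
  have hfin := ((isMaximalCohenMacaulay_quotient_iff hf (C := C)).mp hC).1
  obtain ⟨P, _, _, _, _, g, hg⟩ := Module.exists_finite_presentation R C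
  have hfC (c : C) : f • c = 0 := by
    rw [← algebraMap_smul (Hyp R f), Ideal.Quotient.algebraMap_eq,
      Ideal.Quotient.eq_zero_iff_mem.mpr (Ideal.mem_span_singleton_self f), zero_smul]
  let α : P →ₗ[R] LinearMap.ker g := (LinearMap.lsmul R P f).codRestrict _ fun x => by
    rw [LinearMap.mem_ker, LinearMap.lsmul_apply, map_smul, hfC]
  let M : RMod R f := ofArrows α (LinearMap.ker g).subtype (fun _ => rfl) (fun _ => rfl)
  let e : M ≃ₗ[R] P × LinearMap.ker g :=
    ofArrowsEquiv α (LinearMap.ker g).subtype (fun _ => rfl) (fun _ => rfl)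
  have he (m : M) (y : Gen) : e (m <• gen R f y) = genEnd α (LinearMap.ker g).subtype y (e m) :=
    ofArrowsEquiv_act_gen α (LinearMap.ker g).subtype (fun _ => rfl) (fun _ => rfl) m y
  let eP : plusPart M ≃ₗ[R] P :=
    plusPartOfArrowsEquiv α (LinearMap.ker g).subtype (fun _ => rfl) (fun _ => rfl)
  have hP : IsSMulRegular P f := Module.Flat.isSMulRegular_of_nonZeroDivisors hf
  have hM : IsSMulRegular M f := by
    refine (e.isSMulRegular_congr f).mpr fun x y h => Prod.ext (hP (congrArg Prod.fst h)) ?_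
    exact Subtype.ext (hP (congrArg (fun z : P × LinearMap.ker g => (z.2 : P)) h))
  -- the map `M → C` that is induced by `g` has the same kernel as `toIStar M`
  let ψ : M →ₗ[R] C := g ∘ₗ LinearMap.fst R P (LinearMap.ker g) ∘ₗ e.toLinearMap
  have hψ : Function.Surjective ψ := hg.comp (Prod.fst_surjective.comp e.surjective)
  have hker : LinearMap.ker (toIStar M) = LinearMap.ker ψ := by
    ext m
    rw [LinearMap.mem_ker, LinearMap.mem_ker, toIStar_eq_zero_iff]
    constructor
    · rintro ⟨y, hy⟩
      have h1 := congrArg e hy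
      rw [he, he] at h1
      have h2 : (e m).1 = ((e y).2 : P) := congrArg Prod.fst h1
      exact (congrArg g h2).trans (e y).2.2
    · intro hm
      refine ⟨e.symm (0, ⟨(e m).1, hm⟩), e.injective ?_⟩
      rw [he, he, LinearEquiv.apply_symm_apply]
      rfl
  let E : BalTensor R (Hyp R f) (B R f) (BBar R f) M ≃ₗ[R] C :=
    ((toIStar M).quotKerEquivOfSurjective (toIStar_surjective M)).symm ≪≫ₗ
      Submodule.quotEquivOfEq _ _ hker ≪≫ₗ ψ.quotKerEquivOfSurjective hψ
  have i : (iStar R f).obj M ≅ C :=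
    (E.extendScalarsOfSurjective (S := Hyp R f) Ideal.Quotient.mk_surjective).toModuleIso
  refine ⟨M, ?_, ⟨i⟩⟩
  rw [isCM_iff_isMaximalCohenMacaulay hf M (Module.Finite.equiv (R := R) eP.symm)
    (Module.Projective.of_equiv (R := R) eP.symm) hM]
  exact isMaximalCohenMacaulay_quotient_of_linearEquiv hf i.symm.toLinearEquiv hC

end MatrixFactorizations
end TwoVertex
end

noncomputable section
namespace TwoVertex

section StableEquivalence

open scoped RightActions

variable {R : Type u} [CommRing R] {f : R}

/-! ### The right ideal `e₋ B` -/

theorem smul_eMinus_add_smul_arrowV_mem (x : R × R) : x.1 • eMinus R f + x.2 • arrowV R f ∈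
    (Submodule.span (B R f)ᵐᵒᵖ {eMinus R f} : Submodule (B R f)ᵐᵒᵖ (B R f)) := by
  refine Submodule.mem_span_singleton.mpr
    ⟨MulOpposite.op (x.1 • eMinus R f + x.2 • arrowV R f), ?_⟩
  rw [op_smul_eq_mul, mul_add, mul_smul_comm, mul_smul_comm, eMinus_mul_eMinus,
    eMinus_mul_arrowV]

variable (R f) in
/-- The map `(r, s) ↦ r e₋ + s v` from `R × R` to `e₋ B`. -/
def toEMinusB : R × R →ₗ[R] eMinusB R f where
  toFun x := ⟨x.1 • eMinus R f + x.2 • arrowV R f, smul_eMinus_add_smul_arrowV_mem x⟩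
  map_add' x y := Subtype.ext (by
    change (x.1 + y.1) • eMinus R f + (x.2 + y.2) • arrowV R f =
      (x.1 • eMinus R f + x.2 • arrowV R f) + (y.1 • eMinus R f + y.2 • arrowV R f)
    module)
  map_smul' r x := Subtype.ext (by
    change (r * x.1) • eMinus R f + (r * x.2) • arrowV R f =
      (x.1 • eMinus R f + x.2 • arrowV R f) * algebraMap R (B R f) r
    rw [← Algebra.commutes, ← Algebra.smul_def]
    module)

/-- The elements `e₋` and `v` form a basis of `e₋ B` over `R`. -/
theorem toEMinusB_bijective : Function.Bijective (toEMinusB R f) := by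
  constructor
  · intro x y h
    have h1 (z : R × R) : coords R f (z.1 • eMinus R f + z.2 • arrowV R f) =
        (0, z.1, 0, z.2) := by
      simpa using coords_combination R f 0 z.1 0 z.2
    have h2 := congrArg (coords R f) (congrArg Subtype.val h)
    have h3 := ((h1 x).symm.trans h2).trans (h1 y)
    simp only [Prod.mk.injEq] at h3
    exact Prod.ext h3.2.1 h3.2.2.2
  · rintro ⟨z, hz⟩
    obtain ⟨b, rfl⟩ := Submodule.mem_span_singleton.mp hz
    obtain ⟨p, q, r, s, hb⟩ := exists_eq_combination R f b.unop
    refine ⟨(q, s), Subtype.ext ?_⟩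
    change q • eMinus R f + s • arrowV R f = eMinus R f * b.unop
    rw [hb]
    simp only [mul_add, mul_smul_comm, eMinus_mul_ePlus, eMinus_mul_eMinus, eMinus_mul_arrowU,
      eMinus_mul_arrowV, smul_zero, zero_add, add_zero]

theorem isCM_eMinusB : IsCM (eMinusB R f) :=
  let e := LinearEquiv.ofBijective (toEMinusB R f) toEMinusB_bijective
  ⟨Module.Finite.equiv e, Module.Projective.of_equiv e⟩

/-- The homomorphism `z ↦ y z` from `e₋ B` to `N` for an element `y` of `N`. -/
def homOfElement {N : RMod R f} (y : N) : eMinusB R f ⟶ N :=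
  ModuleCat.ofHom
    { toFun z := y <• (z.1 : B R f)
      map_add' z z' := act_add N y z.1 z'.1
      map_smul' b z := (act_act N y z.1 b.unop).symm }

/-- The homomorphism `m ↦ φ(m v) e₋ + φ(m e₊) v` from `M` to `e₋ B` for a linear form `φ` on
`M₊`. -/
def homOfForm {M : RMod R f} (φ : plusPart M →ₗ[R] R) : M ⟶ eMinusB R f :=
  let g : M →ₗ[R] eMinusB R f := toEMinusB R f ∘ₗ LinearMap.prod
    (φ ∘ₗ (Algebra.lsmul R R M (MulOpposite.op (arrowV R f))).codRestrict _ (act_arrowV_mem M))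
    (φ ∘ₗ (Algebra.lsmul R R M (MulOpposite.op (ePlus R f))).codRestrict _ (act_ePlus_mem M))
  ModuleCat.ofHom
    { toFun := g
      map_add' := map_add g
      map_smul' b m := by
        obtain ⟨b, rfl⟩ := MulOpposite.op_surjective b
        obtain ⟨p, q, r, s, rfl⟩ := exists_eq_combination R f b
        have h1 : (⟨_, act_arrowV_mem M (m <• (p • ePlus R f + q • eMinus R f + r • arrowU R f +
            s • arrowV R f))⟩ : plusPart M) = q • ⟨_, act_arrowV_mem M m⟩ +
              (r * f) • ⟨_, act_ePlus_mem M m⟩ := by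
          refine Subtype.ext ((act_act M m _ _).trans ?_)
          simp only [Submodule.coe_add, Submodule.coe_smul, add_mul, smul_mul_assoc,
            ePlus_mul_arrowV, eMinus_mul_arrowV, arrowU_mul_arrowV, arrowV_mul_arrowV, act_add,
            act_smul, smul_zero, zero_add, add_zero, mul_smul]
        have h2 : (⟨_, act_ePlus_mem M (m <• (p • ePlus R f + q • eMinus R f + r • arrowU R f +
            s • arrowV R f))⟩ : plusPart M) = p • ⟨_, act_ePlus_mem M m⟩ +
              s • ⟨_, act_arrowV_mem M m⟩ := by
          refine Subtype.ext ((act_act M m _ _).trans ?_)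
          simp only [Submodule.coe_add, Submodule.coe_smul, add_mul, smul_mul_assoc,
            ePlus_mul_ePlus, eMinus_mul_ePlus, arrowU_mul_ePlus, arrowV_mul_ePlus, act_add,
            act_smul, smul_zero, add_zero]
        refine Subtype.ext ((congrArg₂ (fun x y => φ x • eMinus R f + φ y • arrowV R f)
          h1 h2).trans ?_)
        change _ = (φ ⟨_, act_arrowV_mem M m⟩ • eMinus R f + φ ⟨_, act_ePlus_mem M m⟩ • arrowV R f) *
            (p • ePlus R f + q • eMinus R f + r • arrowU R f + s • arrowV R f)
        simp only [map_add, map_smul, mul_add, add_mul, smul_mul_smul_comm, eMinus_mul_ePlus,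
          eMinus_mul_eMinus, eMinus_mul_arrowU, eMinus_mul_arrowV, arrowV_mul_ePlus,
          arrowV_mul_eMinus, arrowV_mul_arrowU, arrowV_mul_arrowV, smul_eq_mul]
        module }

theorem homOfElement_homOfForm {M N : RMod R f} (φ : plusPart M →ₗ[R] R) (y : N) (m : M) :
    (homOfForm φ ≫ homOfElement y).hom m =
      φ ⟨_, act_arrowV_mem M m⟩ • (y <• eMinus R f) +
        φ ⟨_, act_ePlus_mem M m⟩ • (y <• arrowV R f) := by
  rw [← act_smul, ← act_smul, ← act_add]
  rfl

/-- A homomorphism in the ideal `⟨e₋ B⟩` induces zero on `i^*`. -/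
theorem toIStar_eq_zero_of_mem_objectIdeal {hE : IsCM (eMinusB R f)} {M N : CMB R f} {g : M ⟶ N}
    (hg : g ∈ objectIdeal (⟨eMinusB R f, hE⟩ : CMB R f) M N) (m : M.obj) :
    toIStar N.obj (g.hom.hom m) = 0 := by
  induction hg using AddSubgroup.closure_induction with
  | mem g hg =>
    obtain ⟨a, b, rfl⟩ := hg
    obtain ⟨z, hz⟩ := toEMinusB_bijective.2 (a.hom.hom m)
    have h1 : a.hom.hom m <• ePlus R f =
        (toEMinusB R f (z.2, 0)) <• arrowV R f := by
      rw [← hz]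
      refine Subtype.ext ?_
      change (z.1 • eMinus R f + z.2 • arrowV R f) * ePlus R f =
        (z.2 • eMinus R f + (0 : R) • arrowV R f) * arrowV R f
      simp only [add_mul, smul_mul_assoc, eMinus_mul_ePlus, arrowV_mul_ePlus, eMinus_mul_arrowV,
        smul_zero, zero_smul, zero_add, add_zero]
    refine (toIStar_eq_zero_iff N.obj _).mpr ⟨b.hom.hom (toEMinusB R f (z.2, 0)), ?_⟩
    have h2 := congrArg b.hom.hom h1
    rwa [map_smul, map_smul] at h2
  | zero => exact map_zero _
  | add g h _ _ hg hh =>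
    refine (map_add (toIStar N.obj) (g.hom.hom m) (h.hom.hom m)).trans ?_
    rw [hg, hh, add_zero]
  | neg g _ hg =>
    refine (map_neg (toIStar N.obj) (g.hom.hom m)).trans ?_
    rw [hg, neg_zero]

/-! ### The equivalence `CM(B) / ⟨e₋ B⟩ ≃ CM(R / (f))` -/

/-- If `f` is regular on `N`, then a linear map `φ` to `N₊` that vanishes in `i^* N` factors
through `v : N₋ → N₊`. -/
theorem exists_arrowVMap_comp_eq {N : RMod R f} (hN : IsSMulRegular N f) {Q : Type*}
    [AddCommGroup Q] [Module R Q] (φ : Q →ₗ[R] plusPart N) (hφ : plusToIStar N ∘ₗ φ = 0) :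
    ∃ ψ : Q →ₗ[R] minusPart N, arrowVMap N ∘ₗ ψ = φ := by
  let e := LinearEquiv.ofInjective (arrowVMap N) (arrowVMap_injective hN)
  have hr (x : Q) : φ x ∈ LinearMap.range (arrowVMap N) :=
    (exact_arrowVMap_plusToIStar N _).mp (LinearMap.congr_fun hφ x)
  refine ⟨e.symm.toLinearMap ∘ₗ φ.codRestrict _ hr, LinearMap.ext fun x => ?_⟩
  exact congrArg Subtype.val (e.apply_symm_apply ⟨φ x, hr x⟩)

/-- A linear map `M₊ → N₊` that is compatible with the maps to `i^* M` and `i^* N` extends to a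
homomorphism `M → N`. -/
theorem exists_hom_extending {M N : RMod R f} (hN : IsSMulRegular N f)
    (φ : plusPart M →ₗ[R] plusPart N) (hφ : plusToIStar N ∘ₗ φ ∘ₗ arrowVMap M = 0) :
    ∃ g : M ⟶ N, ∀ x : plusPart M, g.hom x = φ x := by
  obtain ⟨ψ, hψ⟩ := exists_arrowVMap_comp_eq hN (φ ∘ₗ arrowVMap M) hφ
  let g : M →ₗ[R] N := (partsEquiv N).symm.toLinearMap ∘ₗ φ.prodMap ψ ∘ₗ (partsEquiv M).toLinearMap
  have hg (m : M) : g m = φ ⟨_, act_ePlus_mem M m⟩ + ψ ⟨_, act_eMinus_mem M m⟩ := rfl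
  have hg1 {m : M} (hm : m ∈ plusPart M) : g m = φ ⟨m, hm⟩ := by
    have h1 : (⟨_, act_ePlus_mem M m⟩ : plusPart M) = ⟨m, hm⟩ := Subtype.ext (act_ePlus_eq_self hm)
    have h2 : (⟨_, act_eMinus_mem M m⟩ : minusPart M) = 0 := Subtype.ext (act_eMinus_eq_zero hm)
    rw [hg, h1, h2, map_zero, Submodule.coe_zero, add_zero]
  have hg2 {m : M} (hm : m ∈ minusPart M) : g m = ψ ⟨m, hm⟩ := by
    have h1 : (⟨_, act_ePlus_mem M m⟩ : plusPart M) = 0 := Subtype.ext (act_ePlus_eq_zero hm)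
    have h2 : (⟨_, act_eMinus_mem M m⟩ : minusPart M) = ⟨m, hm⟩ :=
      Subtype.ext (act_eMinus_eq_self hm)
    rw [hg, h1, h2, map_zero, Submodule.coe_zero, zero_add]
  have hp (m : M) : g (m <• ePlus R f) = g m <• ePlus R f := by
    rw [hg1 (act_ePlus_mem M m), hg, smul_add, act_ePlus_eq_self (φ _).2,
      act_ePlus_eq_zero (ψ _).2, add_zero]
  have hq (m : M) : g (m <• eMinus R f) = g m <• eMinus R f := by
    rw [hg2 (act_eMinus_mem M m), hg, smul_add, act_eMinus_eq_zero (φ _).2,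
      act_eMinus_eq_self (ψ _).2, zero_add]
  have hv (m : M) : g (m <• arrowV R f) = g m <• arrowV R f := by
    have h1 : (⟨_, act_arrowV_mem M m⟩ : plusPart M) = arrowVMap M ⟨_, act_eMinus_mem M m⟩ :=
      Subtype.ext (act_eMinus_act_arrowV M m).symm
    rw [hg1 (act_arrowV_mem M m), h1, ← act_eMinus_act_arrowV N, ← hq, hg2 (act_eMinus_mem M m)]
    exact congrArg Subtype.val (LinearMap.congr_fun hψ ⟨_, act_eMinus_mem M m⟩).symm
  -- compatibility with `u` follows after multiplication with `v`, which is injective on `N₋`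
  have hu (m : M) : g (m <• arrowU R f) = g m <• arrowU R f := by
    refine eq_of_act_arrowV_eq hN ?_ (act_arrowU_mem N _) ?_
    · rw [hg2 (act_arrowU_mem M m)]
      exact (ψ _).2
    · rw [← hv, act_act, act_act, arrowU_mul_arrowV, act_smul, act_smul, map_smul, hp]
  exact ⟨ModuleCat.ofHom
    { toFun := g
      map_add' := map_add g
      map_smul' b m := map_act_of_gen g hp hq hu hv b.unop m }, fun x => hg1 x.2⟩

/-- A homomorphism between modules in `CM(B)` that induces zero on `i^*` is a sum of homomorphisms
that factor through `e₋ B`. The restriction `M₊ → N₊` has the form `x ↦ s(x) v` for a linear map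
`s : M₊ → N₋`, and `s` is decomposed by means of a dual basis of `M₊`. -/
theorem mem_objectIdeal_of_toIStar_eq_zero (hf : f ∈ nonZeroDivisors R) {hE : IsCM (eMinusB R f)}
    {M N : CMB R f} {g : M ⟶ N} (hg : ∀ m, toIStar N.obj (g.hom.hom m) = 0) :
    g ∈ objectIdeal (⟨eMinusB R f, hE⟩ : CMB R f) M N := by
  have hN := IsCM.isSMulRegular hf N.property
  obtain ⟨⟨_, _⟩, -⟩ := (isCM_iff M.obj).mp M.property
  let gp : plusPart M.obj →ₗ[R] plusPart N.obj :=
    (g.hom.hom.restrictScalars R).restrict fun m hm => by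
      rw [← act_ePlus_eq_self hm]
      exact ⟨g.hom.hom m, (map_smul g.hom.hom _ m).symm⟩
  obtain ⟨s, hs⟩ := exists_arrowVMap_comp_eq hN gp (LinearMap.ext fun x => hg x)
  obtain ⟨n, p, i, -, -, hpi⟩ := Module.Finite.exists_comp_eq_id_of_projective R (plusPart M.obj)
  let φ (j : Fin n) : plusPart M.obj →ₗ[R] R := LinearMap.proj j ∘ₗ i
  let y (j : Fin n) : N.obj := s (p (Pi.single j 1))
  have hsum (x : plusPart M.obj) : (s x : N.obj) = ∑ j, φ j x • y j := by
    have h1 : s x = ∑ j, φ j x • s (p (Pi.single j 1)) := by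
      conv_lhs => rw [← LinearMap.id_apply (R := R) x, ← hpi, LinearMap.comp_apply,
        pi_eq_sum_univ' (i x)]
      simp only [map_sum, map_smul]
      rfl
    rw [h1]
    simp only [Submodule.coe_sum, Submodule.coe_smul, y]
  have hgs (x : plusPart M.obj) : g.hom.hom x = (s x : N.obj) <• arrowV R f :=
    congrArg Subtype.val (LinearMap.congr_fun hs x).symm
  -- the restriction of `g` to `M₋` is also determined by `s`, as `v` is injective on `N₋`
  have hgv (m : M.obj) : g.hom.hom (m <• eMinus R f) = s ⟨_, act_arrowV_mem M.obj m⟩ := by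
    refine eq_of_act_arrowV_eq hN ⟨g.hom.hom m, (map_smul g.hom.hom _ m).symm⟩ (s _).2 ?_
    rw [← hgs, ← map_smul, act_eMinus_act_arrowV]
  have key : g = ∑ j, (ObjectProperty.homMk (homOfForm (φ j)) : M ⟶ ⟨eMinusB R f, hE⟩) ≫
      (ObjectProperty.homMk (homOfElement (y j))) := by
    refine ObjectProperty.hom_ext _ (ModuleCat.hom_ext (LinearMap.ext fun m => ?_))
    let ev : (M ⟶ N) →+ N.obj :=
      { toFun g := g.hom.hom m, map_zero' := rfl, map_add' := fun _ _ => rfl }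
    refine Eq.trans ?_ (map_sum ev _ _).symm
    refine Eq.trans ?_ (Finset.sum_congr rfl fun j _ =>
      (homOfElement_homOfForm (φ j) (y j) m).symm)
    have h1 (j : Fin n) : y j <• eMinus R f = y j := act_eMinus_eq_self (s _).2
    conv_lhs => rw [← act_ePlus_add_act_eMinus M.obj m, map_add, hgv,
      hgs ⟨_, act_ePlus_mem M.obj m⟩, hsum, hsum]
    simp only [h1, Finset.sum_add_distrib, Finset.smul_sum, smul_act]
    exact add_comm _ _
  rw [key]
  exact sum_mem fun j _ => AddSubgroup.subset_closure ⟨_, _, rfl⟩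

/-- Every homomorphism `i^* M → i^* N` comes from a homomorphism `M → N`, as `M₊` is projective. -/
theorem exists_iStar_map_eq (hf : f ∈ nonZeroDivisors R) {M N : RMod R f} (hM : IsCM M)
    (hN : IsCM N) (h : (iStar R f).obj M ⟶ (iStar R f).obj N) :
    ∃ g : M ⟶ N, (iStar R f).map g = h := by
  obtain ⟨⟨_, _⟩, -⟩ := (isCM_iff M).mp hM
  let h' : BalTensor R (Hyp R f) (B R f) (BBar R f) M →ₗ[Hyp R f]
    BalTensor R (Hyp R f) (B R f) (BBar R f) N := h.hom
  obtain ⟨φ, hφ⟩ := Module.projective_lifting_property (plusToIStar N)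
    (h'.restrictScalars R ∘ₗ plusToIStar M) (plusToIStar_surjective N)
  obtain ⟨g, hg⟩ := exists_hom_extending (hN.isSMulRegular hf) φ (by
    rw [← LinearMap.comp_assoc, hφ, LinearMap.comp_assoc,
      (exact_arrowVMap_plusToIStar M).linearMap_comp_eq_zero, LinearMap.comp_zero])
  refine ⟨g, ModuleCat.hom_ext (LinearMap.ext fun x => ?_)⟩
  obtain ⟨m, rfl⟩ := plusToIStar_surjective M x
  refine Eq.trans ?_ (LinearMap.congr_fun hφ m)
  exact congrArg (toIStar N) (hg m)

/-- The functor `i^*` descends to `CM(B) / ⟨e₋ B⟩`. -/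
theorem iStarCM_map_eq_of_idealRel {hE : IsCM (eMinusB R f)}
    (hCM : ∀ M : CMB R f, IsMaximalCohenMacaulay (Hyp R f) ((iStar R f).obj M.obj))
    {M N : CMB R f} {g h : M ⟶ N} (hgh : idealRel R f hE g h) :
    (iStarCM R f hCM).map g = (iStarCM R f hCM).map h := by
  refine ObjectProperty.hom_ext _ (ModuleCat.hom_ext (LinearMap.ext fun x => ?_))
  obtain ⟨m, rfl⟩ := toIStar_surjective M.obj x
  refine sub_eq_zero.mp ((map_sub (toIStar N.obj) (g.hom.hom m) (h.hom.hom m)).symm.trans ?_)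
  exact toIStar_eq_zero_of_mem_objectIdeal hgh m

/-- The induced functor is faithful by `mem_objectIdeal_of_toIStar_eq_zero`, full by
`exists_iStar_map_eq` and essentially surjective by `exists_isCM_iStar_iso`. -/
theorem isEquivalence_quotient_lift_iStarCM [IsRegularRing R] (hf : f ∈ nonZeroDivisors R)
    (hE : IsCM (eMinusB R f))
    (hCM : ∀ M : CMB R f, IsMaximalCohenMacaulay (Hyp R f) ((iStar R f).obj M.obj))
    (hI : ∀ (M N : CMB R f) (g h : M ⟶ N), idealRel R f hE g h →
      (iStarCM R f hCM).map g = (iStarCM R f hCM).map h) :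
    (CategoryTheory.Quotient.lift (idealRel R f hE) (iStarCM R f hCM) hI).IsEquivalence where
  faithful := ⟨by
    intro M N g h hgh
    obtain ⟨g, rfl⟩ := (CategoryTheory.Quotient.functor (idealRel R f hE)).map_surjective g
    obtain ⟨h, rfl⟩ := (CategoryTheory.Quotient.functor (idealRel R f hE)).map_surjective h
    refine CategoryTheory.Quotient.sound _ (mem_objectIdeal_of_toIStar_eq_zero hf fun m => ?_)
    refine (map_sub (toIStar N.as.obj) (g.hom.hom m) (h.hom.hom m)).trans (sub_eq_zero.mpr ?_)
    have h1 : (iStarCM R f hCM).map g = (iStarCM R f hCM).map h := hgh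
    exact congrArg (fun k => k.hom.hom (toIStar M.as.obj m)) h1⟩
  full := ⟨by
    intro M N h
    obtain ⟨g, hg⟩ := exists_iStar_map_eq hf M.as.property N.as.property h.hom
    exact ⟨(CategoryTheory.Quotient.functor _).map (ObjectProperty.homMk g), ObjectProperty.hom_ext _ hg⟩⟩
  essSurj := ⟨by
    intro C
    obtain ⟨M, hM, ⟨i⟩⟩ := exists_isCM_iStar_iso hf C.property
    exact ⟨(CategoryTheory.Quotient.functor _).obj ⟨M, hM⟩, ⟨ObjectProperty.isoMk _ i⟩⟩⟩

end StableEquivalence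
end TwoVertex
end

theorem mainTheorem4 (R : Type u) [CommRing R] [IsRegularRing R] (f : R) :
    -- If `R` has finite Krull dimension, then `B` is Iwanaga-Gorenstein.
    (ringKrullDim R < ⊤ → IsIwanagaGorenstein (TwoVertex.B R f)) ∧
    (f ∈ nonZeroDivisors R →
      -- If `M₊` is finitely generated projective over `R` and `f` is a nonzerodivisor on `M`,
      -- then `M` is in `CM(B)` iff `i^* M` is in `CM(R/(f))`.
      (∀ M : TwoVertex.RMod R f,
        Module.Finite R (TwoVertex.plusPart M) → Module.Projective R (TwoVertex.plusPart M) →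
        IsSMulRegular M f →
        (TwoVertex.IsCM M ↔
          IsMaximalCohenMacaulay (TwoVertex.Hyp R f) ((TwoVertex.iStar R f).obj M))) ∧
      -- An `R/(f)`-module is in `CM(R/(f))` iff it is isomorphic to `i^* M` for an `M` in `CM(B)`.
      (∀ C : ModuleCat.{u} (TwoVertex.Hyp R f),
        IsMaximalCohenMacaulay (TwoVertex.Hyp R f) C ↔
          ∃ M : TwoVertex.RMod R f, TwoVertex.IsCM M ∧
            Nonempty ((TwoVertex.iStar R f).obj M ≅ C)) ∧
      -- `e₋B` is in `CM(B)`, `i^*` maps `CM(B)` to `CM(R/(f))` and kills the ideal `⟨e₋B⟩`,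
      -- and the functor from `CM(B)/⟨e₋B⟩` to `CM(R/(f))` that it induces is an equivalence.
      ∃ (hE : TwoVertex.IsCM (TwoVertex.eMinusB R f))
        (hCM : ∀ M : TwoVertex.CMB R f,
          IsMaximalCohenMacaulay (TwoVertex.Hyp R f) ((TwoVertex.iStar R f).obj M.obj))
        (hI : ∀ (M N : TwoVertex.CMB R f) (g h : M ⟶ N), TwoVertex.idealRel R f hE g h →
          (TwoVertex.iStarCM R f hCM).map g = (TwoVertex.iStarCM R f hCM).map h),
        (CategoryTheory.Quotient.lift (TwoVertex.idealRel R f hE)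
          (TwoVertex.iStarCM R f hCM) hI).IsEquivalence) := by
  refine ⟨TwoVertex.isIwanagaGorenstein R f, fun hf =>
    ⟨TwoVertex.isCM_iff_isMaximalCohenMacaulay hf, fun C => ⟨TwoVertex.exists_isCM_iStar_iso hf, ?_⟩,
      TwoVertex.isCM_eMinusB, fun M => TwoVertex.isMaximalCohenMacaulay_iStar hf M.property,
      fun _ _ _ _ => TwoVertex.iStarCM_map_eq_of_idealRel _,
      TwoVertex.isEquivalence_quotient_lift_iStarCM hf _ _ _⟩⟩
  rintro ⟨M, hM, ⟨i⟩⟩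
  exact isMaximalCohenMacaulay_quotient_of_linearEquiv hf i.toLinearEquiv
    (TwoVertex.isMaximalCohenMacaulay_iStar hf hM)
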